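/- Let $p$ be a prime, let $k$ be a perfect field of characteristic $p$ with ring of Witt vectors $V = W(k)$, and let $A = W(k)[[X_1,\dots,X_d]]$. Let $\phi : A \to A$ be the Frobenius lift which is the Witt vector Frobenius on $W(k)$ and satisfies $\phi(X_j)=X_j^p$ (that is, the one attached to the $p$-derivation $\delta$ of $A$ with $\delta(X_j)=0$). Let $M=(M_{ab})$ be an $m\times n$ matrix each of whose entries is $0$ or a squarefree monomial in $X_1,\dots,X_d$, let $I_2(M)\subseteq A$ be the ideal generated by the $2\times 2$-minors of $M$, and put $R=A/I_2(M)$. The ideal $I_2(M)$ satisfies $\phi(I_2(M))\subseteq I_2(M)$, so $\phi$ induces $\phi_R : R\to R$. For $i\ge 0$ put $$R_i=\operatorname{colim}\{\underbrace{R\xrightarrow{\phi_R}R\xrightarrow{\phi_R}\cdots\xrightarrow{\phi_R}}_{i\text{ times}}R\},\qquad V_i=V[p^{1/p^i}],\qquad S_i=R_i\otimes_V V_i ,$$ where $R_i$ is a $V$-algebra through $V\to R=R_0\to R_i$, and let $s_i:S_i\to S_{i+1}$ be the tensor product of the canonical map $R_i\to R_{i+1}$ (the identity from the $a$-th copy of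 $R$ to the $a$-th copy, $0\le a\le i$) with the inclusion $V_i\to V_{i+1}$. Put also $A_i=W(k)[[X_1^{1/p^i},\dots,X_d^{1/p^i}]]$ and $\overline{A_i}=A_i/pA_i$, let $M^{1/p^i}=(M_{ab}^{1/p^i})$, a matrix over $A_i$, and let $I_2(M^{1/p^i})\subseteq A_i$ be the ideal of its $2\times2$-minors. *Perfectoid towers.* A tower of rings $T_0\xrightarrow{t_0}T_1\xrightarrow{t_1}\cdots$ is a ($p$-)perfectoid tower arising from $(T_0,I_0)$, where $I_0\subseteq T_0$ is an ideal, if: $p\in I_0$; each induced map $\overline{t_i}:T_i/I_0T_i\to T_{i+1}/I_0T_{i+1}$ is injective and its image contains all $p$-th powers, so that there is a unique ring map $F_i:T_{i+1}/I_0T_{i+1}\to T_i/I_0T_i$ with $\overline{t_i}(F_i(x))=x^p$; each $F_i$ is surjective; $I_0T_i$ lies in the Jacobson radical of $T_i$; $I_0$ is principal and there is a principal ideal $I_1\subseteq T_1$ with $I_1^p=I_0T_1$ and $\ker F_i=I_1(T_{i+1}/I_0T_{i+1})$ for all $i\ge0$; and, writing $(T_i)_{\rm tor}$ for the set of elements of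 $T_i$ killed by a power of $I_0$, one has $I_0(T_i)_{\rm tor}=0$ and there is a bijection $(T_{i+1})_{\rm tor}\to(T_i)_{\rm tor}$ compatible with $F_i$ under the natural maps to $T_{i+1}/I_0T_{i+1}$ and $T_i/I_0T_i$, for every $i\ge 0$. Its tilt is the tower with layers $T_i^{s.\flat}=\varprojlim\{\cdots\xrightarrow{F_{i+1}}T_{i+1}/I_0T_{i+1}\xrightarrow{F_i}T_i/I_0T_i\}$ and transition maps $(a_j)_{j\ge i}\mapsto(\overline{t_j}(a_j))_{j\ge i}$. Suppose that $R/pR$ is reduced. Then: 1. The canonical map $R\to S_0$ is an isomorphism, $(\{S_i\}_{i\ge0},\{s_i\}_{i\ge0})$ is a perfectoid tower arising from $(R,(p))$, and it is isomorphic, as a tower of rings, to $$A/I_2(M)\to \bigl(A_1/I_2(M^{1/p})\bigr)[p^{1/p}]\to \bigl(A_2/I_2(M^{1/p^2})\bigr)[p^{1/p^2}]\to\cdots .$$ 2. The tilt of the tower $(\{S_i\},\{s_i\})$ is isomorphic, as a tower of rings, to $$\overline{A}[[t]]/I_2(M)\overline{A}[[t]]\to \bigl(\overline{A_1}[[t]]/I_2(M^{1/p})\overline{A_1}[[t]]\bigr)[t^{1/p}]\to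 \bigl(\overline{A_2}[[t]]/I_2(M^{1/p^2})\overline{A_2}[[t]]\bigr)[t^{1/p^2}]\to\cdots .$$ Here $B[a^{1/p^i}]$ denotes $B[T]/(T^{p^i}-a)$, with $a^{1/p^i}$ the class of $T$; the transition maps send $X_j^{1/p^i}\mapsto (X_j^{1/p^{i+1}})^p$, $p^{1/p^i}\mapsto (p^{1/p^{i+1}})^p$, $t\mapsto t$, $t^{1/p^i}\mapsto (t^{1/p^{i+1}})^p$ and are the identity on the coefficients in $W(k)$ (respectively $k$). -/

import Mathlib

universe u

/-! ## Towers of rings -/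

/-- A tower of rings `T₀ → T₁ → T₂ → ⋯`. -/
structure RingTower where
  /-- the layers -/
  obj : ℕ → Type u
  [commRing : ∀ i, CommRing (obj i)]
  /-- the transition maps -/
  map : ∀ i, obj i →+* obj (i + 1)

attribute [instance] RingTower.commRing

namespace RingTower

/-- An isomorphism of towers: ring isomorphisms of the layers which commute with the transition
maps. -/
structure Iso (T T' : RingTower.{u}) where
  /-- the isomorphism of the `i`-th layers -/
  equiv : ∀ i, T.obj i ≃+* T'.obj i
  comm : ∀ i x, equiv (i + 1) (T.map i x) = T'.map i (equiv i x)

variable (T : RingTower.{u})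

/-- The composite transition map `T₀ → Tᵢ`. -/
def fromZero : ∀ i, T.obj 0 →+* T.obj i
  | 0 => RingHom.id _
  | i + 1 => (T.map i).comp (fromZero i)

/-- The composite transition map `T₁ → Tᵢ₊₁`. -/
def fromOne : ∀ i, T.obj 1 →+* T.obj (i + 1)
  | 0 => RingHom.id _
  | i + 1 => (T.map (i + 1)).comp (fromOne i)

variable (I : Ideal (T.obj 0))

/-- The ideal `I Tᵢ` of `Tᵢ`, for an ideal `I` of `T₀`. -/
def idealAt (i : ℕ) : Ideal (T.obj i) := I.map (T.fromZero i)

/-- The ring `Tᵢ / I Tᵢ`. -/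
abbrev quot (i : ℕ) : Type u := T.obj i ⧸ T.idealAt I i

lemma idealAt_le_comap (i : ℕ) : T.idealAt I i ≤ (T.idealAt I (i + 1)).comap (T.map i) := by
  rw [← Ideal.map_le_iff_le_comap]
  simp only [idealAt, fromZero, Ideal.map_map]
  exact le_rfl

/-- The map `Tᵢ / I Tᵢ → Tᵢ₊₁ / I Tᵢ₊₁` induced by the transition map. -/
def quotMap (i : ℕ) : T.quot I i →+* T.quot I (i + 1) :=
  Ideal.quotientMap (T.idealAt I (i + 1)) (T.map i) (T.idealAt_le_comap I i)

variable (p : ℕ)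

/-- `T` is a `p`-purely inseparable tower arising from `(T₀, I)`. -/
structure IsPurelyInseparable : Prop where
  p_mem : (p : T.obj 0) ∈ I
  quotMap_injective : ∀ i, Function.Injective (T.quotMap I i)
  pow_mem_range : ∀ i (x : T.quot I (i + 1)), ∃ y : T.quot I i, T.quotMap I i y = x ^ p

variable {T I p}

lemma IsPurelyInseparable.p_eq_zero (h : T.IsPurelyInseparable I p) (i : ℕ) :
    (p : T.quot I i) = 0 := by
  have h1 : (p : T.obj i) ∈ T.idealAt I i := by
    have := Ideal.mem_map_of_mem (T.fromZero i) h.p_mem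
    rwa [map_natCast] at this
  have h2 := Ideal.Quotient.eq_zero_iff_mem.mpr h1
  rwa [map_natCast] at h2

/-- The `i`-th Frobenius projection `Fᵢ : Tᵢ₊₁ / I Tᵢ₊₁ → Tᵢ / I Tᵢ` of a purely inseparable tower,
i.e. the unique ring map whose composite with `Tᵢ / I Tᵢ → Tᵢ₊₁ / I Tᵢ₊₁` is the Frobenius
endomorphism `x ↦ x ^ p`. -/
noncomputable def frobProj [hp : Fact p.Prime] (h : T.IsPurelyInseparable I p) (i : ℕ) :
    T.quot I (i + 1) →+* T.quot I i where
  toFun x := (h.pow_mem_range i x).choose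
  map_one' := h.quotMap_injective i <| by
    rw [(h.pow_mem_range i 1).choose_spec, one_pow, map_one]
  map_mul' x y := h.quotMap_injective i <| by
    rw [map_mul, (h.pow_mem_range i _).choose_spec, (h.pow_mem_range i _).choose_spec,
      (h.pow_mem_range i _).choose_spec, mul_pow]
  map_zero' := h.quotMap_injective i <| by
    rw [(h.pow_mem_range i 0).choose_spec, zero_pow hp.out.ne_zero, map_zero]
  map_add' x y := h.quotMap_injective i <| by
    rw [map_add, (h.pow_mem_range i _).choose_spec, (h.pow_mem_range i _).choose_spec,
      (h.pow_mem_range i _).choose_spec]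
    obtain ⟨r, hr⟩ := (Commute.all x y).exists_add_pow_prime_eq hp.out
    rw [hr, h.p_eq_zero]
    ring

lemma quotMap_frobProj [Fact p.Prime] (h : T.IsPurelyInseparable I p) (i : ℕ)
    (x : T.quot I (i + 1)) : T.quotMap I i (frobProj h i x) = x ^ p :=
  (h.pow_mem_range i x).choose_spec

lemma frobProj_quotMap [Fact p.Prime] (h : T.IsPurelyInseparable I p) (i : ℕ)
    (x : T.quot I i) : frobProj h i (T.quotMap I i x) = x ^ p :=
  h.quotMap_injective i <| by rw [quotMap_frobProj, map_pow]

/-- The `J`-torsion elements of a ring `B`: those killed by some power of `J`. -/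
def torsionSet {B : Type*} [CommRing B] (J : Ideal B) : Set B :=
  {x | ∃ n : ℕ, ∀ a ∈ J ^ n, a * x = 0}

variable (T I p)

/-- `T` is a `p`-perfectoid tower arising from `(T₀, I)`. -/
structure IsPerfectoid [Fact p.Prime] : Prop extends IsPurelyInseparable T I p where
  frobProj_surjective : ∀ i, Function.Surjective (frobProj toIsPurelyInseparable i)
  zariskian : ∀ i, T.idealAt I i ≤ (⊥ : Ideal (T.obj i)).jacobson
  isPrincipal : Submodule.IsPrincipal I
  exists_pillar : ∃ I₁ : Ideal (T.obj 1), Submodule.IsPrincipal I₁ ∧ I₁ ^ p = T.idealAt I 1 ∧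
    ∀ i, RingHom.ker (frobProj toIsPurelyInseparable i) =
      (I₁.map (T.fromOne i)).map (Ideal.Quotient.mk (T.idealAt I (i + 1)))
  mul_torsion : ∀ i, ∀ a ∈ T.idealAt I i, ∀ x ∈ torsionSet (T.idealAt I i), a * x = 0
  exists_torsion_bijection : ∀ i,
    ∃ G : torsionSet (T.idealAt I (i + 1)) → torsionSet (T.idealAt I i), Function.Bijective G ∧
      ∀ x, frobProj toIsPurelyInseparable i (Ideal.Quotient.mk _ x.1) =
        Ideal.Quotient.mk _ (G x).1

variable {T I p}

/-- The `i`-th small tilt: the inverse limit of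
`⋯ → Tᵢ₊₂ / I Tᵢ₊₂ → Tᵢ₊₁ / I Tᵢ₊₁ → Tᵢ / I Tᵢ` along the Frobenius projections, i.e. the ring of
sequences `(aⱼ)_{j ≥ i}` with `aⱼ ∈ Tⱼ / I Tⱼ` and `Fⱼ(aⱼ₊₁) = aⱼ`. -/
def smallTilt [Fact p.Prime] (h : T.IsPurelyInseparable I p) (i : ℕ) :
    Subring (∀ j : {j : ℕ // i ≤ j}, T.quot I j.1) where
  carrier := {a | ∀ j (hj : i ≤ j), frobProj h j (a ⟨j + 1, Nat.le_succ_of_le hj⟩) = a ⟨j, hj⟩}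
  mul_mem' ha hb j hj := by simp only [Pi.mul_apply, map_mul, ha j hj, hb j hj]
  one_mem' j hj := by simp only [Pi.one_apply, map_one]
  add_mem' ha hb j hj := by simp only [Pi.add_apply, map_add, ha j hj, hb j hj]
  zero_mem' j hj := by simp only [Pi.zero_apply, map_zero]
  neg_mem' ha j hj := by simp only [Pi.neg_apply, map_neg, ha j hj]

/-- The component at `l` of the image of `(aⱼ)_{j ≥ i}` under the transition map of the tilt. -/
def tiltMapFun (i : ℕ) (a : ∀ j : {j : ℕ // i ≤ j}, T.quot I j.1) :
    ∀ l : {l : ℕ // i + 1 ≤ l}, T.quot I l.1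
  | ⟨0, hl⟩ => absurd hl (Nat.not_succ_le_zero i)
  | ⟨j + 1, hl⟩ => T.quotMap I j (a ⟨j, Nat.le_of_succ_le_succ hl⟩)

/-- The transition map of the tilt: it maps `aⱼ ∈ Tⱼ / I Tⱼ`, `j ≥ i`, to its image in
`Tⱼ₊₁ / I Tⱼ₊₁`. -/
def tiltMap [Fact p.Prime] (h : T.IsPurelyInseparable I p) (i : ℕ) :
    smallTilt h i →+* smallTilt h (i + 1) where
  toFun a := ⟨tiltMapFun i a.1, by
    rintro (_ | j) hl
    · exact absurd hl (Nat.not_succ_le_zero i)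
    · simp only [tiltMapFun]
      rw [frobProj_quotMap, ← a.2 j (Nat.le_of_succ_le_succ hl), quotMap_frobProj]⟩
  map_one' := Subtype.ext <| by
    funext ⟨l, hl⟩
    cases l with
    | zero => exact absurd hl (Nat.not_succ_le_zero i)
    | succ j => exact map_one _
  map_mul' a b := Subtype.ext <| by
    funext ⟨l, hl⟩
    cases l with
    | zero => exact absurd hl (Nat.not_succ_le_zero i)
    | succ j => exact map_mul _ _ _
  map_zero' := Subtype.ext <| by
    funext ⟨l, hl⟩
    cases l with
    | zero => exact absurd hl (Nat.not_succ_le_zero i)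
    | succ j => exact map_zero _
  map_add' a b := Subtype.ext <| by
    funext ⟨l, hl⟩
    cases l with
    | zero => exact absurd hl (Nat.not_succ_le_zero i)
    | succ j => exact map_add _ _ _

/-- The tilt of the tower `T`. -/
def tilt [Fact p.Prime] (h : T.IsPurelyInseparable I p) : RingTower.{u} where
  obj i := smallTilt h i
  map i := tiltMap h i

end RingTower

/-! ## Adjoining roots -/

/-- `B[a^{1/n}] = B[T] / (T ^ n - a)`. -/
abbrev RootExt (B : Type u) [CommRing B] (a : B) (n : ℕ) : Type u :=
  AdjoinRoot (Polynomial.X ^ n - Polynomial.C a : Polynomial B)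

namespace RootExt

/-- The element `a^{1/n}` of `B[a^{1/n}]`. -/
noncomputable def root (B : Type u) [CommRing B] (a : B) (n : ℕ) : RootExt B a n :=
  AdjoinRoot.root _

lemma root_pow {B : Type u} [CommRing B] (a : B) (n : ℕ) :
    root B a n ^ n = AdjoinRoot.of _ a := by
  have h := AdjoinRoot.eval₂_root (Polynomial.X ^ n - Polynomial.C a : Polynomial B)
  rw [Polynomial.eval₂_sub, Polynomial.eval₂_pow, Polynomial.eval₂_X, Polynomial.eval₂_C] at h
  exact sub_eq_zero.mp h

lemma eval₂_eq_zero {B C : Type u} [CommRing B] [CommRing C] (f : B →+* C) {a : B} {b : C}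
    (hab : f a = b) (p i : ℕ) :
    Polynomial.eval₂ ((AdjoinRoot.of (Polynomial.X ^ p ^ (i + 1) - Polynomial.C b)).comp f)
      (root C b (p ^ (i + 1)) ^ p) (Polynomial.X ^ p ^ i - Polynomial.C a) = 0 := by
  rw [Polynomial.eval₂_sub, Polynomial.eval₂_pow, Polynomial.eval₂_X, Polynomial.eval₂_C,
    ← pow_mul, mul_comm, ← pow_succ, root_pow, RingHom.comp_apply, hab, sub_self]

/-- The map `B[a^{1/pⁱ}] → C[b^{1/pⁱ⁺¹}]` which extends a ring map `f : B → C` with `f a = b` and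
sends `a^{1/pⁱ}` to `(b^{1/pⁱ⁺¹})ᵖ`. -/
noncomputable def map {B C : Type u} [CommRing B] [CommRing C] (f : B →+* C) {a : B} {b : C}
    (hab : f a = b) (p i : ℕ) : RootExt B a (p ^ i) →+* RootExt C b (p ^ (i + 1)) :=
  AdjoinRoot.lift ((AdjoinRoot.of _).comp f) (root C b (p ^ (i + 1)) ^ p)
    (eval₂_eq_zero f hab p i)

/-- The `V`-algebra map `t'ᵢ : V[a^{1/pⁱ}] → V[a^{1/pⁱ⁺¹}]`, `a^{1/pⁱ} ↦ (a^{1/pⁱ⁺¹})ᵖ`. -/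
noncomputable def incl (V : Type u) [CommRing V] (a : V) (p i : ℕ) :
    RootExt V a (p ^ i) →ₐ[V] RootExt V a (p ^ (i + 1)) :=
  { map (RingHom.id V) (rfl : RingHom.id V a = a) p i with
    commutes' := fun _ => AdjoinRoot.lift_of (eval₂_eq_zero (RingHom.id V) rfl p i) }

end RootExt

/-! ## The finite perfections along a ring endomorphism and the tower `Rᵢ ⊗ Vᵢ` -/

section FrobColim

variable {R : Type u} [CommRing R] (φ : R →+* R)

/-- `Rᵢ = colim (R → R → ⋯ → R)`, with `i` transition maps, all equal to `φ`. -/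
def FrobColim (i : ℕ) : Type u :=
  Ring.DirectLimit (fun _ : Fin (i + 1) => R) (fun a b _ => (φ^[(b : ℕ) - (a : ℕ)] : R → R))

noncomputable instance (i : ℕ) : CommRing (FrobColim φ i) :=
  inferInstanceAs (CommRing (Ring.DirectLimit _ _))

/-- The canonical map from the `a`-th copy of `R` to the colimit `Rᵢ`. -/
noncomputable def FrobColim.of (i : ℕ) (a : Fin (i + 1)) : R →+* FrobColim φ i :=
  Ring.DirectLimit.of (fun _ : Fin (i + 1) => R)
    (fun a b _ => (φ^[(b : ℕ) - (a : ℕ)] : R → R)) a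

/-- The transition map `Rᵢ → Rᵢ₊₁`, induced by the identity from the `a`-th copy of `R` to the
`a`-th copy of `R` for `a ≤ i`. -/
noncomputable def FrobColim.trans (i : ℕ) : FrobColim φ i →+* FrobColim φ (i + 1) :=
  Ring.DirectLimit.lift _ _ _ (fun a : Fin (i + 1) => FrobColim.of φ (i + 1) a.castSucc)
    (fun a b hab x => Ring.DirectLimit.of_f (G := fun _ : Fin (i + 2) => R)
      (f := fun a b _ => (φ^[(b : ℕ) - (a : ℕ)] : R → R))
      (i := a.castSucc) (j := b.castSucc) hab x)

variable (V : Type u) [CommRing V] [Algebra V R]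

/-- `Rᵢ` is a `V`-algebra through `V → R = R₀ → Rᵢ`. -/
noncomputable instance (i : ℕ) : Algebra V (FrobColim φ i) :=
  ((FrobColim.of φ i 0).comp (algebraMap V R)).toAlgebra

/-- The transition map `Rᵢ → Rᵢ₊₁` as a map of `V`-algebras. -/
noncomputable def FrobColim.transAlgHom (i : ℕ) : FrobColim φ i →ₐ[V] FrobColim φ (i + 1) :=
  { FrobColim.trans φ i with
    commutes' := fun v => Ring.DirectLimit.lift_of (G := fun _ : Fin (i + 1) => R) _ _ _ 0
      (algebraMap V R v) }

/-- The tower with layers `Sᵢ = Rᵢ ⊗_V V[p^{1/pⁱ}]` and transition maps `(Rᵢ → Rᵢ₊₁) ⊗ t'ᵢ`. -/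
noncomputable def tensorTower (p : ℕ) : RingTower.{u} where
  obj i := TensorProduct V (FrobColim φ i) (RootExt V (p : V) (p ^ i))
  map i := (Algebra.TensorProduct.map (FrobColim.transAlgHom φ V i)
    (RootExt.incl V (p : V) p i)).toRingHom

/-- The canonical map `R → R₀ ⊗_V V₀`, `r ↦ r ⊗ 1`. -/
noncomputable def toTensorTower (p : ℕ) : R →+* (tensorTower φ V p).obj 0 :=
  (Algebra.TensorProduct.includeLeftRingHom :
    FrobColim φ 0 →+* TensorProduct V (FrobColim φ 0) (RootExt V (p : V) (p ^ 0))).comp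
    (FrobColim.of φ 0 0)

end FrobColim

/-! ## Determinantal ideals -/

/-- The ideal `I_t(N)` generated by the `t × t`-minors of the matrix `N`. -/
def minorsIdeal (t : ℕ) {m n : ℕ} {B : Type*} [CommRing B] (N : Matrix (Fin m) (Fin n) B) :
    Ideal B :=
  Ideal.span (Set.range fun rc : (Fin t ↪o Fin m) × (Fin t ↪o Fin n) =>
    (N.submatrix rc.1 rc.2).det)

lemma minorsIdeal_two_le_comap {m n : ℕ} {B C : Type*} [CommRing B] [CommRing C] (p : ℕ)
    (f : B →+* C) (N : Matrix (Fin m) (Fin n) B) (N' : Matrix (Fin m) (Fin n) C)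
    (h : ∀ a b, f (N a b) = N' a b ^ p) :
    minorsIdeal 2 N ≤ (minorsIdeal 2 N').comap f := by
  refine Ideal.span_le.mpr ?_
  rintro _ ⟨rc, rfl⟩
  have hmem : (N'.submatrix rc.1 rc.2).det ∈ minorsIdeal 2 N' :=
    Ideal.subset_span ⟨rc, rfl⟩
  change f (N.submatrix rc.1 rc.2).det ∈ minorsIdeal 2 N'
  refine Ideal.mem_of_dvd _ ?_ hmem
  simp only [Matrix.det_fin_two, Matrix.submatrix_apply, map_sub, map_mul, h, ← mul_pow]
  exact sub_dvd_pow_sub_pow _ _ _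

section Determinantal

variable (p : ℕ) [hp : Fact p.Prime] (k : Type u) [Field k] (d : ℕ)

/-- `Aᵢ = W(k)⟦X₁^{1/pⁱ}, …, X_d^{1/pⁱ}⟧`: the power series ring over `W(k)` whose variables, the
`MvPowerSeries.X j` of Lean, stand for the `X_j^{1/pⁱ}`. In particular `A = A₀`. -/
abbrev RootSeries (_i : ℕ) : Type u := MvPowerSeries (Fin d) (WittVector p k)

/-- The inclusion `Aᵢ → Aᵢ₊₁`: it is the identity on `W(k)` and sends the variable `X_j^{1/pⁱ}`
to `(X_j^{1/pⁱ⁺¹})ᵖ`. -/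
noncomputable def RootSeries.incl (i : ℕ) : RootSeries p k d i →+* RootSeries p k d (i + 1) :=
  (MvPowerSeries.expand p hp.out.ne_zero).toRingHom

/-- The Frobenius lift `φ` on `A = W(k)⟦X₁, …, X_d⟧` which is the Witt vector Frobenius on `W(k)`
and sends `X_j` to `X_jᵖ`. -/
noncomputable def frobLift : RootSeries p k d 0 →+* RootSeries p k d 0 :=
  (MvPowerSeries.expand p hp.out.ne_zero).toRingHom.comp
    (MvPowerSeries.map (WittVector.frobenius (p := p) (R := k)))

/-- `φ` lifts the Frobenius of `A / pA`. As `A` has no `p`-torsion, `φ(f) = fᵖ + p δ(f)` then defines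
a `p`-derivation `δ`, and `δ(X_j) = 0`. -/
lemma frobLift_sub_pow_mem [CharP k p] [PerfectRing k p] (f : RootSeries p k d 0) :
    frobLift p k d f - f ^ p ∈ Ideal.span {(p : RootSeries p k d 0)} := by
  have h0 : MvPowerSeries.map (WittVector.constantCoeff (p := p) (R := k)) (frobLift p k d f) =
      MvPowerSeries.map (WittVector.constantCoeff (p := p) (R := k)) (f ^ p) := by
    have hc : (WittVector.constantCoeff (p := p) (R := k)).comp WittVector.frobenius =
        (frobenius k p).comp WittVector.constantCoeff :=
      RingHom.ext fun x => WittVector.coeff_frobenius_charP p x 0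
    rw [map_pow, ← MvPowerSeries.map_frobenius_expand p hp.out.ne_zero,
      MvPowerSeries.map_expand, frobLift, RingHom.comp_apply, AlgHom.toRingHom_eq_coe,
      RingHom.coe_coe, MvPowerSeries.map_expand, ← RingHom.comp_apply, ← RingHom.comp_apply,
      ← MvPowerSeries.map_comp, ← MvPowerSeries.map_comp, hc]
  have h1 : ∀ e, (p : WittVector p k) ∣ MvPowerSeries.coeff e (frobLift p k d f - f ^ p) := by
    intro e
    rw [← Ideal.mem_span_singleton, ← WittVector.ker_constantCoeff, RingHom.mem_ker,
      ← MvPowerSeries.coeff_map, map_sub, h0, sub_self, map_zero]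
  choose g hg using h1
  have h2 : ∀ G : RootSeries p k d 0, (∀ e, MvPowerSeries.coeff e G = g e) →
      frobLift p k d f - f ^ p = (p : RootSeries p k d 0) * G := by
    refine fun G hG => MvPowerSeries.ext fun e => ?_
    rw [hg e, ← nsmul_eq_mul, ← nsmul_eq_mul, map_nsmul, hG]
  exact Ideal.mem_span_singleton.mpr ⟨_, h2 (fun e => g e) fun _ => rfl⟩

variable {p k d} {m n : ℕ}

/-- The monomial `∏_{j ∈ s} X_j^{1/pⁱ}` of `Aᵢ`, or `0`; so for `i = 0` a squarefree monomial or `0`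
in `A`, and for general `i` the `pⁱ`-th root of the latter. -/
noncomputable def rootMonomial (i : ℕ) : Option (Finset (Fin d)) → RootSeries p k d i
  | none => 0
  | some s => ∏ j ∈ s, MvPowerSeries.X j

variable (p k)

/-- The matrix `M^{1/pⁱ}` over `Aᵢ`, for a matrix `M` of squarefree monomials or zeros. -/
noncomputable def rootMatrix (M : Matrix (Fin m) (Fin n) (Option (Finset (Fin d)))) (i : ℕ) :
    Matrix (Fin m) (Fin n) (RootSeries p k d i) :=
  M.map (rootMonomial i)

variable (M : Matrix (Fin m) (Fin n) (Option (Finset (Fin d))))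

/-- `Aᵢ / I₂(M^{1/pⁱ})`. For `i = 0` this is the ring `R = A / I₂(M)`. -/
abbrev DetRing (i : ℕ) : Type u := RootSeries p k d i ⧸ minorsIdeal 2 (rootMatrix p k M i)

variable {p k} in
lemma incl_rootMonomial (i : ℕ) (s : Option (Finset (Fin d))) :
    RootSeries.incl p k d i (rootMonomial i s) = rootMonomial (i + 1) s ^ p := by
  cases s with
  | none => simp [rootMonomial, hp.out.ne_zero]
  | some s =>
    simp only [rootMonomial, map_prod, RootSeries.incl, ← Finset.prod_pow]
    exact Finset.prod_congr rfl fun j _ => MvPowerSeries.expand_X p hp.out.ne_zero j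

variable {p k} in
lemma frobLift_rootMonomial (s : Option (Finset (Fin d))) :
    frobLift p k d (rootMonomial 0 s) = rootMonomial 0 s ^ p := by
  cases s with
  | none => simp [rootMonomial, hp.out.ne_zero]
  | some s =>
    simp only [rootMonomial, map_prod, frobLift, ← Finset.prod_pow]
    refine Finset.prod_congr rfl fun j _ => ?_
    rw [RingHom.comp_apply, MvPowerSeries.map_X]
    exact MvPowerSeries.expand_X p hp.out.ne_zero j

/-- The inclusion-induced map `Aᵢ / I₂(M^{1/pⁱ}) → Aᵢ₊₁ / I₂(M^{1/pⁱ⁺¹})`. -/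
noncomputable def DetRing.trans (i : ℕ) : DetRing p k M i →+* DetRing p k M (i + 1) :=
  Ideal.quotientMap _ (RootSeries.incl p k d i)
    (minorsIdeal_two_le_comap p _ _ _ fun a b => incl_rootMonomial i (M a b))

/-- The endomorphism `φ_R` of `R = A / I₂(M)` induced by `φ`. -/
noncomputable def DetRing.frob : DetRing p k M 0 →+* DetRing p k M 0 :=
  Ideal.quotientMap _ (frobLift p k d)
    (minorsIdeal_two_le_comap p _ _ _ fun a b => frobLift_rootMonomial (M a b))

/-- The tower with layers `(Aᵢ / I₂(M^{1/pⁱ}))[p^{1/pⁱ}]`. -/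
noncomputable def detTower : RingTower.{u} where
  obj i := RootExt (DetRing p k M i) (p : DetRing p k M i) (p ^ i)
  map i := RootExt.map (DetRing.trans p k M i) (map_natCast _ p) p i

variable (d) in
/-- `Āᵢ = Aᵢ / p Aᵢ`. -/
abbrev RootSeriesBar (i : ℕ) : Type u :=
  RootSeries p k d i ⧸ Ideal.span {(p : RootSeries p k d i)}

variable (d) in
/-- The map `Āᵢ → Āᵢ₊₁` induced by the inclusion `Aᵢ → Aᵢ₊₁`. -/
noncomputable def RootSeriesBar.trans (i : ℕ) :
    RootSeriesBar p k d i →+* RootSeriesBar p k d (i + 1) :=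
  Ideal.quotientMap _ (RootSeries.incl p k d i) <| by
    rw [Ideal.span_singleton_le_iff_mem, Ideal.mem_comap, map_natCast]
    exact Ideal.mem_span_singleton_self _

/-- The ideal of `Āᵢ⟦t⟧` generated by the image of `I₂(M^{1/pⁱ})`. -/
noncomputable def detIdealBar (i : ℕ) : Ideal (PowerSeries (RootSeriesBar p k d i)) :=
  ((minorsIdeal 2 (rootMatrix p k M i)).map
    (Ideal.Quotient.mk (Ideal.span {(p : RootSeries p k d i)}))).map PowerSeries.C

/-- `Āᵢ⟦t⟧ / I₂(M^{1/pⁱ}) Āᵢ⟦t⟧`. -/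
abbrev DetRingBar (i : ℕ) : Type u :=
  PowerSeries (RootSeriesBar p k d i) ⧸ detIdealBar p k M i

/-- The element `t` of `Āᵢ⟦t⟧ / I₂(M^{1/pⁱ}) Āᵢ⟦t⟧`. -/
noncomputable def DetRingBar.t (i : ℕ) : DetRingBar p k M i :=
  Ideal.Quotient.mk _ PowerSeries.X

lemma detIdealBar_le_comap (i : ℕ) :
    detIdealBar p k M i ≤
      (detIdealBar p k M (i + 1)).comap (PowerSeries.map (RootSeriesBar.trans p k d i)) := by
  rw [← Ideal.map_le_iff_le_comap]
  simp only [detIdealBar, Ideal.map_map]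
  rw [Ideal.map_le_iff_le_comap]
  intro x hx
  have h1 : RootSeries.incl p k d i x ∈ minorsIdeal 2 (rootMatrix p k M (i + 1)) :=
    minorsIdeal_two_le_comap p _ _ _ (fun a b => incl_rootMonomial i (M a b)) hx
  have h2 := Ideal.mem_map_of_mem (PowerSeries.C.comp
    (Ideal.Quotient.mk (Ideal.span {(p : RootSeries p k d (i + 1))}))) h1
  rw [Ideal.mem_comap]
  convert h2 using 1
  simp only [RingHom.comp_apply, PowerSeries.map_C, RootSeriesBar.trans, Ideal.quotientMap_mk]

/-- The map `Āᵢ⟦t⟧ / I₂(M^{1/pⁱ}) Āᵢ⟦t⟧ → Āᵢ₊₁⟦t⟧ / I₂(M^{1/pⁱ⁺¹}) Āᵢ₊₁⟦t⟧` which is induced by the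
inclusion `Aᵢ → Aᵢ₊₁` and fixes `t`. -/
noncomputable def DetRingBar.trans (i : ℕ) : DetRingBar p k M i →+* DetRingBar p k M (i + 1) :=
  Ideal.quotientMap _ (PowerSeries.map (RootSeriesBar.trans p k d i))
    (detIdealBar_le_comap p k M i)

lemma DetRingBar.trans_t (i : ℕ) : DetRingBar.trans p k M i (t p k M i) = t p k M (i + 1) := by
  simp only [t, trans, Ideal.quotientMap_mk, PowerSeries.map_X]

/-- The tower with layers `(Āᵢ⟦t⟧ / I₂(M^{1/pⁱ}) Āᵢ⟦t⟧)[t^{1/pⁱ}]`. -/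
noncomputable def detTowerBar : RingTower.{u} where
  obj i := RootExt (DetRingBar p k M i) (DetRingBar.t p k M i) (p ^ i)
  map i := RootExt.map (DetRingBar.trans p k M i) (DetRingBar.trans_t p k M i) p i

end Determinantal

/-! The Frobenius lift factors as `φ = σ ∘ θ`, where `σ` is the Witt vector Frobenius on
coefficients (an automorphism, as `k` is perfect) and `θ` is the `W(k)`-linear map `X_j ↦ X_jᵖ`.
Both preserve `I₂(M)` and they commute. In the colimit `Rᵢ` the last copy of `R` is final, so `Rᵢ ≃
R`; after a twist by `σ⁻ⁱ` this is `V`-linear and the transition maps become `θ`. Hence `Sᵢ ≃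
R[p^{1/pⁱ}]` with transitions given by `θ`. Since `Aᵢ` is `A` with renamed variables, this is
already the tower of part 1 (`tensorTowerIso`).

Put `B = R/p`. Modulo `p` the layer `R[p^{1/pⁱ}]` is `B⟦X⟧/(X^{pⁱ})`, and the transition map is
induced by `psi`: `θ` on coefficients, `X ↦ Xᵖ`. As `σθ` is the Frobenius of the reduced ring `B`,
`θ` is injective on `B`; the Frobenius projection is `σ` on coefficients followed by truncation. The
axioms on the quotients modulo `p` can be read off (`TruncatedPresentation.isPerfectoid`).
Untwisting by powers of `σ`, the inverse limit is that of the `B⟦X⟧/(X^{pʲ})`, so every layer of the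
tilt is `B⟦X⟧`, with transition `psi` (`tiltIso`). The tower of part 2 is the same one, because
`B⟦t⟧[t^{1/pⁱ}] ≃ B⟦X⟧` with `t = X^{pⁱ}` (`isoPowerSeriesTower`).

It remains that `p` is a nonzerodivisor on `R` (`Ideal.mem_of_natCast_mul_mem`). Let `δ(f) = (φ(f) -
fᵖ)/p`. A minor is a difference of two elements killed by `δ`, so `I₂(M)` is stable under `δ`; this,
reducedness of `R/p` and `p`-adic completeness of `A` exclude `p`-torsion. -/

/-! ## Towers presented by truncated power series -/

/-- A factorization `σ ∘ θ` of the Frobenius of a ring `B` of characteristic `p` into an injective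
endomorphism `θ` and an automorphism `σ`. -/
structure FrobeniusFactorization (p : ℕ) (B : Type u) [CommRing B] where
  /-- the automorphism -/
  σ : B ≃+* B
  /-- the injective endomorphism -/
  θ : B →+* B
  σ_θ : ∀ b, σ (θ b) = b ^ p
  θ_injective : Function.Injective θ
  natCast_eq_zero : (p : B) = 0

/-! ### Divisibility by powers of the variable, and the Frobenius of a power series ring. -/

namespace PowerSeries

lemma X_pow_dvd_expand_iff {B : Type*} [CommRing B] {p : ℕ} (hp : p ≠ 0) (N : ℕ)
    (f : PowerSeries B) : X ^ (p * N) ∣ expand p hp f ↔ X ^ N ∣ f := by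
  constructor
  · intro h
    rw [X_pow_dvd_iff] at h ⊢
    intro m hm
    rw [← coeff_expand_mul p hp]
    exact h _ (Nat.mul_lt_mul_of_pos_left hm (Nat.pos_of_ne_zero hp))
  · rintro ⟨g, rfl⟩
    rw [map_mul, map_pow, expand_X, ← pow_mul]
    exact dvd_mul_right _ _

lemma X_pow_dvd_map_iff {B C : Type*} [CommRing B] [CommRing C] {θ : B →+* C}
    (hθ : Function.Injective θ) (N : ℕ) (f : PowerSeries B) :
    X ^ N ∣ map θ f ↔ X ^ N ∣ f := by
  simp only [X_pow_dvd_iff, coeff_map, map_eq_zero_iff θ hθ]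

lemma map_frobenius_expand' {B : Type*} [CommRing B] {p : ℕ} [hp : Fact p.Prime]
    (hB : (p : B) = 0) {φ : B →+* B} (hφ : ∀ b, φ b = b ^ p) (f : PowerSeries B) :
    map φ (expand p hp.out.ne_zero f) = f ^ p := by
  rcases subsingleton_or_nontrivial B with h | h
  · exact Subsingleton.elim _ _
  · have : CharP B p := (CharP.charP_iff_prime_eq_zero hp.out).mpr hB
    have h1 : φ = frobenius B p := RingHom.ext hφ
    rw [h1]
    exact MvPowerSeries.map_frobenius_expand p hp.out.ne_zero

lemma mk_eq_zero_iff_X_pow_dvd {B : Type*} [CommRing B] (N : ℕ) (f : PowerSeries B) :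
    Ideal.Quotient.mk (Ideal.span {(X : PowerSeries B) ^ N}) f = 0 ↔ X ^ N ∣ f := by
  rw [Ideal.Quotient.eq_zero_iff_mem, Ideal.mem_span_singleton]

end PowerSeries

/-! ### The maps `sig`, `tau` and `psi` on `B⟦X⟧`. -/

namespace FrobeniusFactorization

variable {p : ℕ} {B : Type u} [CommRing B] (F : FrobeniusFactorization p B)

/-- The automorphism `σ` applied to the coefficients. -/
noncomputable def sig : PowerSeries B →+* PowerSeries B := PowerSeries.map F.σ.toRingHom

/-- The inverse of `σ` applied to the coefficients. -/
noncomputable def tau : PowerSeries B →+* PowerSeries B := PowerSeries.map F.σ.symm.toRingHom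

lemma sig_tau (f : PowerSeries B) : F.sig (F.tau f) = f := by
  ext n
  simp [sig, tau]

lemma tau_sig (f : PowerSeries B) : F.tau (F.sig f) = f := by
  ext n
  simp [sig, tau]

lemma X_pow_dvd_sig_iff (N : ℕ) (f : PowerSeries B) :
    PowerSeries.X ^ N ∣ F.sig f ↔ PowerSeries.X ^ N ∣ f :=
  PowerSeries.X_pow_dvd_map_iff F.σ.injective N f

lemma X_pow_dvd_tau_iff (N : ℕ) (f : PowerSeries B) :
    PowerSeries.X ^ N ∣ F.tau f ↔ PowerSeries.X ^ N ∣ f :=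
  PowerSeries.X_pow_dvd_map_iff F.σ.symm.injective N f

lemma X_pow_dvd_tau_pow_iff (N n : ℕ) (f : PowerSeries B) :
    PowerSeries.X ^ N ∣ (F.tau ^ n) f ↔ PowerSeries.X ^ N ∣ f := by
  induction n with
  | zero => rw [pow_zero, RingHom.one_def, RingHom.id_apply]
  | succ n ih => rw [pow_succ', RingHom.mul_def, RingHom.comp_apply, F.X_pow_dvd_tau_iff, ih]

lemma sig_pow_tau_pow (n : ℕ) (f : PowerSeries B) : (F.tau ^ n) ((F.sig ^ n) f) = f := by
  induction n with
  | zero => rfl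
  | succ n ih =>
    rw [pow_succ, pow_succ', RingHom.mul_def, RingHom.comp_apply, RingHom.mul_def,
      RingHom.comp_apply, F.tau_sig, ih]

lemma σ_θ_comm (b : B) : F.σ (F.θ b) = F.θ (F.σ b) := by
  apply F.σ.injective
  rw [F.σ_θ, F.σ_θ, map_pow]

variable [hp : Fact p.Prime]

/-- The endomorphism of `B⟦X⟧` which is `θ` on the coefficients and sends `X` to `X ^ p`. -/
noncomputable def psi : PowerSeries B →+* PowerSeries B :=
  (PowerSeries.expand p hp.out.ne_zero).toRingHom.comp (PowerSeries.map F.θ)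

lemma psi_apply (f : PowerSeries B) :
    F.psi f = PowerSeries.expand p hp.out.ne_zero (PowerSeries.map F.θ f) := rfl

/-- This gives both well-definedness and injectivity of `psi : B⟦X⟧/(X^{pⁱ}) → B⟦X⟧/(X^{pⁱ⁺¹})`;
injectivity rests on that of `θ`. -/
lemma X_pow_dvd_psi_iff (i : ℕ) (f : PowerSeries B) :
    PowerSeries.X ^ p ^ (i + 1) ∣ F.psi f ↔ PowerSeries.X ^ p ^ i ∣ f := by
  rw [pow_succ', psi_apply, PowerSeries.X_pow_dvd_expand_iff,
    PowerSeries.X_pow_dvd_map_iff F.θ_injective]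

lemma psi_X_pow (m : ℕ) : F.psi (PowerSeries.X ^ m) = PowerSeries.X ^ (p * m) := by
  rw [psi_apply, map_pow, map_pow, PowerSeries.map_X, PowerSeries.expand_X, pow_mul]

/-- In characteristic `p` the Frobenius of `B⟦X⟧` is the coefficientwise Frobenius, here `σ ∘ θ`,
composed with `X ↦ Xᵖ`. -/
lemma sig_psi (f : PowerSeries B) : F.sig (F.psi f) = f ^ p := by
  rw [psi_apply, sig, ← PowerSeries.map_frobenius_expand' F.natCast_eq_zero
    (φ := F.σ.toRingHom.comp F.θ) F.σ_θ, PowerSeries.map_expand, PowerSeries.map_expand,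
    PowerSeries.map_comp, RingHom.comp_apply]

lemma psi_sig (f : PowerSeries B) : F.psi (F.sig f) = f ^ p := by
  rw [← F.sig_psi f, psi_apply, sig, psi_apply, PowerSeries.map_expand]
  congr 1
  ext n
  simp [F.σ_θ_comm]

lemma tau_psi (f : PowerSeries B) : F.tau (F.psi f) = F.psi (F.tau f) := by
  have h : F.sig (F.tau (F.psi f)) = F.sig (F.psi (F.tau f)) := by
    rw [sig_tau, sig_psi, ← psi_sig, sig_tau]
  rw [← F.tau_sig (F.tau (F.psi f)), h, tau_sig]

/-- The tower `B⟦X⟧ → B⟦X⟧ → ⋯` with all transition maps equal to `psi`. -/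
noncomputable def powerSeriesTower : RingTower.{u} where
  obj _ := PowerSeries B
  map _ := F.psi

end FrobeniusFactorization

/-! ### Perfectoid axioms for a tower presented by truncated power series. -/

namespace RingTower

variable {p : ℕ} [hp : Fact p.Prime] {B : Type u} [CommRing B]

/-- Surjections `Tᵢ → B⟦X⟧ / (X ^ pⁱ)` with kernel `(p)`, compatible with the transition maps. -/
structure TruncatedPresentation (T : RingTower.{u}) (F : FrobeniusFactorization p B) where
  /-- the surjection from the `i`-th layer -/
  e : ∀ i, T.obj i →+* PowerSeries B ⧸ Ideal.span {(PowerSeries.X : PowerSeries B) ^ p ^ i}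
  surjective : ∀ i, Function.Surjective (e i)
  ker_eq : ∀ i, RingHom.ker (e i) = Ideal.span {(p : T.obj i)}
  -- Quantifying over every lift `f` avoids descending `psi` to the truncations.
  e_map : ∀ i x f, e i x = Ideal.Quotient.mk _ f →
    e (i + 1) (T.map i x) = Ideal.Quotient.mk _ (F.psi f)

namespace TruncatedPresentation

variable {T : RingTower.{u}} {F : FrobeniusFactorization p B} (E : T.TruncatedPresentation F)

lemma _root_.RingTower.idealAt_span_natCast (T : RingTower.{u}) (p i : ℕ) :
    T.idealAt (Ideal.span {(p : T.obj 0)}) i = Ideal.span {(p : T.obj i)} := by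
  rw [idealAt, Ideal.map_span, Set.image_singleton, map_natCast]

/-- With `p` a nonzerodivisor the torsion sets are `{0}`, so the torsion axioms become trivial. -/
lemma _root_.RingTower.eq_zero_of_mem_torsionSet (T : RingTower.{u}) {p : ℕ}
    (hreg : ∀ i (x : T.obj i), p * x = 0 → x = 0) (i : ℕ) {x : T.obj i}
    (hx : x ∈ torsionSet (T.idealAt (Ideal.span {(p : T.obj 0)}) i)) : x = 0 := by
  obtain ⟨n, hn⟩ := hx
  have h := hn (p ^ n) (Ideal.pow_mem_pow (by
    rw [T.idealAt_span_natCast]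
    exact Ideal.mem_span_singleton_self _) n)
  induction n with
  | zero => simpa using h
  | succ n ih =>
    rw [pow_succ', mul_assoc] at h
    have h' := hreg i _ h
    refine ih (fun a ha => ?_) h'
    rw [T.idealAt_span_natCast, Ideal.span_singleton_pow, Ideal.mem_span_singleton] at ha
    obtain ⟨b, rfl⟩ := ha
    rw [mul_right_comm, h', zero_mul]

lemma mk_eq_mk_iff (i : ℕ) (x y : T.obj i) :
    Ideal.Quotient.mk (T.idealAt (Ideal.span {(p : T.obj 0)}) i) x =
        Ideal.Quotient.mk (T.idealAt (Ideal.span {(p : T.obj 0)}) i) y ↔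
      E.e i x = E.e i y := by
  rw [Ideal.Quotient.eq, T.idealAt_span_natCast, ← E.ker_eq, RingHom.mem_ker, map_sub, sub_eq_zero]

lemma exists_lift (i : ℕ) (f : PowerSeries B) : ∃ x : T.obj i, E.e i x = Ideal.Quotient.mk _ f :=
  E.surjective i _

lemma exists_eq_mk (i : ℕ) (x : T.obj i) :
    ∃ f : PowerSeries B, E.e i x = Ideal.Quotient.mk _ f := by
  obtain ⟨f, hf⟩ := Ideal.Quotient.mk_surjective (E.e i x)
  exact ⟨f, hf.symm⟩

lemma isPurelyInseparable (E : T.TruncatedPresentation F) :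
    T.IsPurelyInseparable (Ideal.span {(p : T.obj 0)}) p where
  p_mem := Ideal.mem_span_singleton_self _
  quotMap_injective i := by
    rw [injective_iff_map_eq_zero]
    intro x hx
    obtain ⟨x, rfl⟩ := Ideal.Quotient.mk_surjective x
    obtain ⟨f, hf⟩ := E.exists_eq_mk i x
    rw [quotMap, Ideal.quotientMap_mk, ← map_zero (Ideal.Quotient.mk _), E.mk_eq_mk_iff,
      E.e_map i x f hf, map_zero, PowerSeries.mk_eq_zero_iff_X_pow_dvd, F.X_pow_dvd_psi_iff,
      ← PowerSeries.mk_eq_zero_iff_X_pow_dvd, ← hf] at hx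
    rw [← map_zero (Ideal.Quotient.mk _), E.mk_eq_mk_iff, hx, map_zero]
  pow_mem_range i x := by
    obtain ⟨x, rfl⟩ := Ideal.Quotient.mk_surjective x
    obtain ⟨f, hf⟩ := E.exists_eq_mk _ x
    obtain ⟨y, hy⟩ := E.exists_lift i (F.sig f)
    refine ⟨Ideal.Quotient.mk _ y, ?_⟩
    rw [quotMap, Ideal.quotientMap_mk, ← map_pow, E.mk_eq_mk_iff, E.e_map i y _ hy, F.psi_sig,
      map_pow, map_pow, hf]

/-- Since `psi ∘ sig` is the Frobenius and `quotMap` is injective, the Frobenius projection must be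
`sig` followed by truncation from `X^{pⁱ⁺¹}` to `X^{pⁱ}`. -/
lemma frobProj_mk_eq (h : T.IsPurelyInseparable (Ideal.span {(p : T.obj 0)}) p) (i : ℕ)
    (x : T.obj (i + 1)) (y : T.obj i) (f : PowerSeries B) (hx : E.e (i + 1) x = Ideal.Quotient.mk _ f)
    (hy : E.e i y = Ideal.Quotient.mk _ (F.sig f)) :
    frobProj h i (Ideal.Quotient.mk _ x) = Ideal.Quotient.mk _ y := by
  apply h.quotMap_injective i
  rw [quotMap_frobProj, quotMap, Ideal.quotientMap_mk, ← map_pow, E.mk_eq_mk_iff,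
    E.e_map i y _ hy, F.psi_sig, map_pow, map_pow, hx]

lemma e_fromOne {ϖ : T.obj 1} (h : E.e 1 ϖ = Ideal.Quotient.mk _ PowerSeries.X) (i : ℕ) :
    E.e (i + 1) (T.fromOne i ϖ) = Ideal.Quotient.mk _ (PowerSeries.X ^ p ^ i) := by
  induction i with
  | zero => simpa [fromOne] using h
  | succ i ih =>
    have := E.e_map (i + 1) _ _ ih
    rw [F.psi_X_pow, ← pow_succ'] at this
    exact this

/-- The Frobenius projection is `sig` followed by truncation: it is onto because `sig` is bijective,
and its kernel is `(X^{pⁱ})`, which is generated by the image of `ϖ`, a `p`-th root of `p`. -/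
theorem isPerfectoid {ϖ : T.obj 1} (hϖ : ϖ ^ p = p)
    (heϖ : E.e 1 ϖ = Ideal.Quotient.mk _ PowerSeries.X)
    (hreg : ∀ i (x : T.obj i), p * x = 0 → x = 0)
    (hjac : ∀ i, (p : T.obj i) ∈ (⊥ : Ideal (T.obj i)).jacobson) :
    T.IsPerfectoid (Ideal.span {(p : T.obj 0)}) p where
  toIsPurelyInseparable := E.isPurelyInseparable
  frobProj_surjective i y := by
    obtain ⟨y, rfl⟩ := Ideal.Quotient.mk_surjective y
    obtain ⟨f, hf⟩ := E.exists_eq_mk _ y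
    obtain ⟨x, hx⟩ := E.exists_lift (i + 1) (F.tau f)
    exact ⟨_, E.frobProj_mk_eq _ i x y _ hx (by rw [F.sig_tau, hf])⟩
  zariskian i := by
    rw [T.idealAt_span_natCast, Ideal.span_singleton_le_iff_mem]
    exact hjac i
  isPrincipal := ⟨_, rfl⟩
  exists_pillar := by
    refine ⟨Ideal.span {ϖ}, ⟨_, rfl⟩, ?_, fun i => ?_⟩
    · rw [Ideal.span_singleton_pow, hϖ, T.idealAt_span_natCast]
    · rw [Ideal.map_span, Set.image_singleton, Ideal.map_span, Set.image_singleton]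
      ext x
      obtain ⟨x, rfl⟩ := Ideal.Quotient.mk_surjective x
      obtain ⟨f, hf⟩ := E.exists_eq_mk _ x
      obtain ⟨y, hy⟩ := E.exists_lift i (F.sig f)
      rw [RingHom.mem_ker, E.frobProj_mk_eq _ i x y f hf hy, ← map_zero (Ideal.Quotient.mk _),
        E.mk_eq_mk_iff, hy, map_zero, PowerSeries.mk_eq_zero_iff_X_pow_dvd, F.X_pow_dvd_sig_iff,
        Ideal.mem_span_singleton]
      constructor
      · rintro ⟨g, rfl⟩
        obtain ⟨z, hz⟩ := E.exists_lift (i + 1) g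
        refine ⟨Ideal.Quotient.mk _ z, ?_⟩
        rw [← map_mul, E.mk_eq_mk_iff, hf, map_mul, map_mul, E.e_fromOne heϖ, hz]
      · rintro ⟨z, hz⟩
        obtain ⟨z, rfl⟩ := Ideal.Quotient.mk_surjective z
        obtain ⟨g, hg⟩ := E.exists_eq_mk _ z
        rw [← map_mul, E.mk_eq_mk_iff, hf, map_mul, E.e_fromOne heϖ, hg, ← map_mul,
          Ideal.Quotient.eq, Ideal.mem_span_singleton] at hz
        -- The equation in `Tᵢ₊₁/p` holds only modulo `X^{pⁱ⁺¹}`, which does no harm as `X^{pⁱ}`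
        -- divides it.
        have h1 : (PowerSeries.X : PowerSeries B) ^ p ^ i ∣ PowerSeries.X ^ p ^ (i + 1) :=
          pow_dvd_pow _ (Nat.pow_le_pow_right hp.out.pos (Nat.le_succ i))
        exact (dvd_sub_left (dvd_mul_right _ g)).mp (h1.trans hz)
  mul_torsion i a _ x hx := by
    rw [T.eq_zero_of_mem_torsionSet hreg i hx, mul_zero]
  exists_torsion_bijection i := by
    have h0 : ∀ j, (0 : T.obj j) ∈ torsionSet (T.idealAt (Ideal.span {(p : T.obj 0)}) j) :=
      fun j => ⟨0, by simp⟩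
    refine ⟨fun _ => ⟨0, h0 i⟩, ⟨fun x y _ => ?_, fun y => ⟨⟨0, h0 _⟩, ?_⟩⟩, fun x => ?_⟩
    · exact Subtype.ext ((T.eq_zero_of_mem_torsionSet hreg _ x.2).trans
        (T.eq_zero_of_mem_torsionSet hreg _ y.2).symm)
    · exact Subtype.ext (T.eq_zero_of_mem_torsionSet hreg _ y.2).symm
    · rw [T.eq_zero_of_mem_torsionSet hreg _ x.2, map_zero, map_zero, map_zero]

end TruncatedPresentation
end RingTower

/-! ### The tilt of a presented tower. -/

namespace RingTower.TruncatedPresentation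

variable {p : ℕ} [hp : Fact p.Prime] {B : Type u} [CommRing B]
variable {T : RingTower.{u}} {F : FrobeniusFactorization p B} (E : T.TruncatedPresentation F)

/-- The isomorphism `Tᵢ / p Tᵢ ≃ B⟦X⟧ / (X ^ pⁱ)`. -/
noncomputable def quotEquiv (i : ℕ) : T.quot (Ideal.span {(p : T.obj 0)}) i ≃+*
    PowerSeries B ⧸ Ideal.span {(PowerSeries.X : PowerSeries B) ^ p ^ i} :=
  (Ideal.quotEquivOfEq ((T.idealAt_span_natCast p i).trans (E.ker_eq i).symm)).trans
    (RingHom.quotientKerEquivOfSurjective (E.surjective i))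

lemma quotEquiv_mk (i : ℕ) (x : T.obj i) : E.quotEquiv i (Ideal.Quotient.mk _ x) = E.e i x := rfl

lemma frobProj_quotEquiv_symm (h : T.IsPurelyInseparable (Ideal.span {(p : T.obj 0)}) p) (i : ℕ)
    (f : PowerSeries B) :
    frobProj h i ((E.quotEquiv (i + 1)).symm (Ideal.Quotient.mk _ f)) =
      (E.quotEquiv i).symm (Ideal.Quotient.mk _ (F.sig f)) := by
  obtain ⟨x, hx⟩ := E.exists_lift (i + 1) f
  obtain ⟨y, hy⟩ := E.exists_lift i (F.sig f)
  rw [← hx, ← hy, ← quotEquiv_mk, ← quotEquiv_mk, RingEquiv.symm_apply_apply,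
    RingEquiv.symm_apply_apply]
  exact E.frobProj_mk_eq h i x y f hx hy

lemma quotMap_quotEquiv_symm (i : ℕ) (f : PowerSeries B) :
    T.quotMap (Ideal.span {(p : T.obj 0)}) i ((E.quotEquiv i).symm (Ideal.Quotient.mk _ f)) =
      (E.quotEquiv (i + 1)).symm (Ideal.Quotient.mk _ (F.psi f)) := by
  obtain ⟨x, hx⟩ := E.exists_lift i f
  rw [← hx, ← E.e_map i x f hx, ← quotEquiv_mk, ← quotEquiv_mk, RingEquiv.symm_apply_apply,
    RingEquiv.symm_apply_apply, quotMap, Ideal.quotientMap_mk]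

variable (h : T.IsPurelyInseparable (Ideal.span {(p : T.obj 0)}) p)

/-- The sequence of truncations of the power series `τʲ⁻ⁱ(f)`, `j ≥ i`, as an element of the
`i`-th small tilt. -/
noncomputable def toSmallTilt (i : ℕ) : PowerSeries B →+* smallTilt h i :=
  (RingHom.pi fun j : {j : ℕ // i ≤ j} =>
    ((E.quotEquiv j.1).symm.toRingHom.comp (Ideal.Quotient.mk _)).comp
      (F.tau ^ (j.1 - i))).codRestrict (smallTilt h i) fun f j hj => by
    refine (E.frobProj_quotEquiv_symm h j ((F.tau ^ (j + 1 - i)) f)).trans ?_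
    rw [Nat.succ_sub hj, pow_succ', RingHom.mul_def, RingHom.comp_apply, F.sig_tau]
    rfl

lemma toSmallTilt_apply (i : ℕ) (f : PowerSeries B) (j : {j : ℕ // i ≤ j}) :
    (E.toSmallTilt h i f).1 j =
      (E.quotEquiv j.1).symm (Ideal.Quotient.mk _ ((F.tau ^ (j.1 - i)) f)) := rfl

lemma toSmallTilt_injective (i : ℕ) : Function.Injective (E.toSmallTilt h i) := by
  rw [injective_iff_map_eq_zero]
  intro f hf
  have h1 : ∀ n, PowerSeries.X ^ p ^ (i + n) ∣ f := fun n => by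
    have h2 := congrFun (congrArg Subtype.val hf) ⟨i + n, Nat.le_add_right i n⟩
    rw [toSmallTilt_apply] at h2
    replace h2 := (map_eq_zero_iff _ (RingEquiv.injective _)).mp h2
    rwa [PowerSeries.mk_eq_zero_iff_X_pow_dvd, F.X_pow_dvd_tau_pow_iff] at h2
  ext n
  exact PowerSeries.X_pow_dvd_iff.mp (h1 n) n
    ((Nat.lt_pow_self hp.out.one_lt).trans_le (Nat.pow_le_pow_right hp.out.pos (by omega)))

lemma toSmallTilt_surjective (i : ℕ) : Function.Surjective (E.toSmallTilt h i) := by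
  intro a
  have h1 : ∀ n, ∃ g : PowerSeries B,
      (E.quotEquiv (i + n)).symm (Ideal.Quotient.mk _ g) = a.1 ⟨i + n, Nat.le_add_right i n⟩ :=
    fun n => by
      obtain ⟨g, hg⟩ := Ideal.Quotient.mk_surjective (E.quotEquiv (i + n) (a.1 ⟨i + n, _⟩))
      exact ⟨g, by rw [hg, RingEquiv.symm_apply_apply]⟩
  choose g hg using h1
  -- Applying `sig ^ n` undoes the twist: compatibility under the Frobenius projections becomes
  -- `X`-adic convergence of `c`.
  set c : ℕ → PowerSeries B := fun n => (F.sig ^ n) (g n) with hc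
  have h2 : ∀ n, PowerSeries.X ^ p ^ (i + n) ∣ c (n + 1) - c n := fun n => by
    have h3 := a.2 (i + n) (Nat.le_add_right i n)
    rw [← hg n] at h3
    have h4 : a.1 ⟨i + n + 1, _⟩ = _ := (hg (n + 1)).symm
    rw [h4] at h3
    erw [E.frobProj_quotEquiv_symm] at h3
    replace h3 := RingEquiv.injective _ h3
    rw [Ideal.Quotient.eq, Ideal.mem_span_singleton] at h3
    rw [← F.X_pow_dvd_tau_pow_iff _ n, map_sub, hc, F.sig_pow_tau_pow]
    simp only
    rwa [pow_succ, RingHom.mul_def, RingHom.comp_apply, F.sig_pow_tau_pow]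
  have h5 : ∀ n m, n ≤ m → ∀ l < p ^ (i + n),
      PowerSeries.coeff l (c m) = PowerSeries.coeff l (c n) := fun n m hnm l hl => by
    induction m, hnm using Nat.le_induction with
    | base => rfl
    | succ m hnm ih =>
      rw [← ih, ← sub_eq_zero, ← map_sub]
      exact PowerSeries.X_pow_dvd_iff.mp (h2 m) l
        (hl.trans_le (Nat.pow_le_pow_right hp.out.pos (by omega)))
  -- The `l`-th coefficient of `c` is constant from index `l` on, because `l < p ^ (i + l)`; the
  -- limit is therefore read off diagonally.
  refine ⟨PowerSeries.mk fun l => PowerSeries.coeff l (c l), ?_⟩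
  refine Subtype.ext (funext fun ⟨j, hj⟩ => ?_)
  obtain ⟨n, rfl⟩ := Nat.exists_eq_add_of_le hj
  rw [← hg n, toSmallTilt_apply]
  refine congrArg _ ?_
  simp only [Nat.add_sub_cancel_left]
  rw [Ideal.Quotient.eq, Ideal.mem_span_singleton, ← F.sig_pow_tau_pow n (g n), ← map_sub,
    F.X_pow_dvd_tau_pow_iff, PowerSeries.X_pow_dvd_iff]
  intro l hl
  rw [map_sub, PowerSeries.coeff_mk, sub_eq_zero, ← h5 l (max l n) (le_max_left _ _) l
    ((Nat.lt_pow_self hp.out.one_lt).trans_le (Nat.pow_le_pow_right hp.out.pos (by omega))),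
    h5 n (max l n) (le_max_right _ _) l hl]

lemma tau_pow_psi (n : ℕ) (f : PowerSeries B) : (F.tau ^ n) (F.psi f) = F.psi ((F.tau ^ n) f) := by
  induction n with
  | zero => rfl
  | succ n ih =>
    rw [pow_succ', RingHom.mul_def, RingHom.comp_apply, RingHom.comp_apply, ih, F.tau_psi]

/-- The tilt transition moves the component at `j` to `j + 1`, and the exponents of `tau` agree
since `(j + 1) - (i + 1) = j - i`; `tau` commutes with `psi`. -/
lemma toSmallTilt_psi (i : ℕ) (f : PowerSeries B) :
    E.toSmallTilt h (i + 1) (F.psi f) = tiltMap h i (E.toSmallTilt h i f) := by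
  refine Subtype.ext (funext fun ⟨j, hj⟩ => ?_)
  obtain _ | j := j
  · exact absurd hj (Nat.not_succ_le_zero i)
  · rw [toSmallTilt_apply, tau_pow_psi]
    refine (E.quotMap_quotEquiv_symm j _).symm.trans ?_
    simp only [Nat.add_sub_add_right]
    rfl

/-- The isomorphism of `B⟦X⟧` with the `i`-th small tilt. -/
noncomputable def smallTiltEquiv (i : ℕ) : PowerSeries B ≃+* smallTilt h i :=
  RingEquiv.ofBijective (E.toSmallTilt h i)
    ⟨E.toSmallTilt_injective h i, E.toSmallTilt_surjective h i⟩

/-- The tilt of a tower with a truncated presentation over `B` is the tower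
`B⟦X⟧ → B⟦X⟧ → ⋯`. -/
noncomputable def tiltIso : (tilt h).Iso F.powerSeriesTower where
  equiv i := (E.smallTiltEquiv h i).symm
  comm i x := (RingEquiv.symm_apply_eq (E.smallTiltEquiv h (i + 1))).mpr <|
    Eq.trans (congrArg (tiltMap h i) (RingEquiv.apply_symm_apply (E.smallTiltEquiv h i) x).symm)
      (E.toSmallTilt_psi h i ((E.smallTiltEquiv h i).symm x)).symm

end RingTower.TruncatedPresentation

/-! ## The tower `R[p^{1/pⁱ}]` -/

namespace RootExt

variable {R : Type u} [CommRing R] (a : R) {N : ℕ}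

lemma monic (hN : N ≠ 0) : (Polynomial.X ^ N - Polynomial.C a : Polynomial R).Monic :=
  Polynomial.monic_X_pow_sub_C a hN

lemma exists_mk_eq (hN : N ≠ 0) (x : RootExt R a N) :
    ∃ g : Polynomial R, AdjoinRoot.mk _ g = x ∧ ∀ n, N ≤ n → g.coeff n = 0 := by
  -- The zero ring occurs in the application: the empty product `1` is an allowed entry, so a minor
  -- can be a unit. Over it the degree of `X ^ N - C a` is not `N`.
  rcases subsingleton_or_nontrivial R with h | h
  · obtain ⟨g, hg⟩ := AdjoinRoot.mk_surjective x
    exact ⟨g, hg, fun n _ => Subsingleton.elim _ _⟩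
  obtain ⟨g, rfl⟩ := AdjoinRoot.mk_surjective x
  refine ⟨g %ₘ (Polynomial.X ^ N - Polynomial.C a), ?_, fun n hn => ?_⟩
  · exact AdjoinRoot.mk_leftInverse (monic a hN) (AdjoinRoot.mk _ g)
  · refine Polynomial.coeff_eq_zero_of_degree_lt ?_
    refine (Polynomial.degree_modByMonic_lt g (monic a hN)).trans_le ?_
    rw [Polynomial.degree_X_pow_sub_C (Nat.pos_of_ne_zero hN)]
    exact_mod_cast hn

lemma eq_zero_of_mk_eq_zero (hN : N ≠ 0) {g : Polynomial R} (hg : ∀ n, N ≤ n → g.coeff n = 0)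
    (h : AdjoinRoot.mk (Polynomial.X ^ N - Polynomial.C a) g = 0) : g = 0 := by
  rcases subsingleton_or_nontrivial R with h' | h'
  · exact Subsingleton.elim _ _
  have h1 := congrArg (AdjoinRoot.modByMonicHom (monic a hN)) h
  rw [AdjoinRoot.modByMonicHom_mk, map_zero, (Polynomial.modByMonic_eq_self_iff (monic a hN)).mpr]
    at h1
  · exact h1
  · rw [Polynomial.degree_X_pow_sub_C (Nat.pos_of_ne_zero hN)]
    exact (Polynomial.degree_lt_iff_coeff_zero g N).mpr hg

/-- The classes of `1, T, …, T^{N-1}` form a basis over `R`, and `r` acts coefficientwise. -/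
lemma eq_zero_of_of_mul_eq_zero (hN : N ≠ 0) {r : R} (hr : ∀ x, r * x = 0 → x = 0)
    {x : RootExt R a N} (h : AdjoinRoot.of _ r * x = 0) : x = 0 := by
  obtain ⟨g, rfl, hg⟩ := exists_mk_eq a hN x
  rw [← AdjoinRoot.mk_C, ← map_mul] at h
  have h1 := eq_zero_of_mk_eq_zero a hN (g := Polynomial.C r * g)
    (fun n hn => by rw [Polynomial.coeff_C_mul, hg n hn, mul_zero]) h
  have h2 : g = 0 := by
    ext n
    have := congrArg (fun f => Polynomial.coeff f n) h1
    simp only [Polynomial.coeff_C_mul, Polynomial.coeff_zero] at this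
    rw [hr _ this, Polynomial.coeff_zero]
  rw [h2, map_zero]

/-- The extension is integral, so each of its maximal ideals contracts to a maximal ideal of `R`,
which contains `r`. -/
lemma of_mem_jacobson_bot (hN : N ≠ 0) {r : R} (hr : r ∈ (⊥ : Ideal R).jacobson) :
    AdjoinRoot.of _ r ∈ (⊥ : Ideal (RootExt R a N)).jacobson := by
  have := (monic a hN).finite_adjoinRoot
  have hint : Algebra.IsIntegral R (RootExt R a N) := Algebra.IsIntegral.of_finite R _
  rw [Ideal.jacobson, Ideal.mem_sInf] at hr ⊢
  rintro m ⟨-, hm⟩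
  have hmax : (m.comap (algebraMap R (RootExt R a N))).IsMaximal :=
    Ideal.isMaximal_comap_of_isIntegral_of_isMaximal m
  exact hr ⟨bot_le, hmax⟩

lemma eq_zero_of_natCast_mul_eq_zero (hN : N ≠ 0) {n : ℕ} (hr : ∀ x : R, n * x = 0 → x = 0)
    {x : RootExt R a N} (h : n * x = 0) : x = 0 := by
  rw [← map_natCast (AdjoinRoot.of (Polynomial.X ^ N - Polynomial.C a))] at h
  exact eq_zero_of_of_mul_eq_zero a hN hr h

lemma natCast_mem_jacobson_bot (hN : N ≠ 0) {n : ℕ} (hn : (n : R) ∈ (⊥ : Ideal R).jacobson) :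
    (n : RootExt R a N) ∈ (⊥ : Ideal (RootExt R a N)).jacobson := by
  have h := of_mem_jacobson_bot a hN hn
  rwa [map_natCast] at h

lemma map_of {C : Type u} [CommRing C] (f : R →+* C) {a : R} {b : C} (hab : f a = b) (p i : ℕ)
    (r : R) : map f hab p i (AdjoinRoot.of _ r) = AdjoinRoot.of _ (f r) :=
  AdjoinRoot.lift_of (eval₂_eq_zero f hab p i)

lemma map_root {C : Type u} [CommRing C] (f : R →+* C) {a : R} {b : C} (hab : f a = b) (p i : ℕ) :
    map f hab p i (AdjoinRoot.root _) = AdjoinRoot.root _ ^ p :=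
  AdjoinRoot.lift_root (eval₂_eq_zero f hab p i)

end RootExt

lemma RingEquiv.natCast_mem_jacobson_bot {S S' : Type*} [CommRing S] [CommRing S'] (e : S ≃+* S')
    {n : ℕ} (hn : (n : S') ∈ (⊥ : Ideal S').jacobson) : (n : S) ∈ (⊥ : Ideal S).jacobson := by
  rw [Ideal.mem_jacobson_bot] at hn ⊢
  intro y
  have h := (hn (e y)).map e.symm
  rwa [map_add, map_mul, map_one, map_natCast, RingEquiv.symm_apply_apply] at h

lemma RingEquiv.eq_zero_of_natCast_mul_eq_zero {S S' : Type*} [CommRing S] [CommRing S']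
    (e : S ≃+* S') {n : ℕ} (hn : ∀ x : S', n * x = 0 → x = 0) {x : S} (hx : n * x = 0) : x = 0 := by
  apply e.injective
  rw [map_zero]
  apply hn
  rw [← map_natCast e, ← map_mul, hx, map_zero]

/-- The tower with layers `R[p^{1/pⁱ}]` and transition maps induced by an endomorphism `θ`. -/
noncomputable def rootTower {R : Type u} [CommRing R] (θ : R →+* R) (p : ℕ) : RingTower.{u} where
  obj i := RootExt R (p : R) (p ^ i)
  map i := RootExt.map θ (map_natCast _ p) p i

namespace rootTower

variable {p : ℕ} {R : Type u} [CommRing R]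

variable (p R) in
/-- The reduction `R[X] → (R/p)⟦X⟧ / (X ^ N)`. -/
noncomputable def polyMap (N : ℕ) : Polynomial R →+*
    PowerSeries (R ⧸ Ideal.span {(p : R)}) ⧸
      Ideal.span {(PowerSeries.X : PowerSeries (R ⧸ Ideal.span {(p : R)})) ^ N} :=
  ((Ideal.Quotient.mk _).comp Polynomial.coeToPowerSeries.ringHom).comp
    (Polynomial.mapRingHom (Ideal.Quotient.mk _))

lemma polyMap_apply (N : ℕ) (f : Polynomial R) : polyMap p R N f = Ideal.Quotient.mk _
    ((f.map (Ideal.Quotient.mk (Ideal.span {(p : R)})) : Polynomial (R ⧸ Ideal.span {(p : R)})) :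
      PowerSeries (R ⧸ Ideal.span {(p : R)})) := rfl

lemma polyMap_C (N : ℕ) (r : R) : polyMap p R N (Polynomial.C r) =
    Ideal.Quotient.mk _ (PowerSeries.C (Ideal.Quotient.mk (Ideal.span {(p : R)}) r)) := by
  rw [polyMap_apply, Polynomial.map_C, Polynomial.coe_C]

lemma polyMap_X (N : ℕ) : polyMap p R N Polynomial.X = Ideal.Quotient.mk _ PowerSeries.X := by
  rw [polyMap_apply, Polynomial.map_X, Polynomial.coe_X]

lemma eval₂_polyMap (N : ℕ) (f : Polynomial R) :
    f.eval₂ ((polyMap p R N).comp Polynomial.C) (polyMap p R N Polynomial.X) = polyMap p R N f := by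
  rw [← Polynomial.hom_eval₂, Polynomial.eval₂_C_X]

lemma polyMap_X_pow_sub_C (N : ℕ) :
    polyMap p R N (Polynomial.X ^ N - Polynomial.C (p : R)) = 0 := by
  have h1 : Ideal.Quotient.mk (Ideal.span {(p : R)}) (p : R) = 0 :=
    Ideal.Quotient.eq_zero_iff_mem.mpr (Ideal.mem_span_singleton_self _)
  rw [map_sub, map_pow, polyMap_X, polyMap_C, h1, map_zero, map_zero, sub_zero, ← map_pow,
    PowerSeries.mk_eq_zero_iff_X_pow_dvd]

variable (p R) in
/-- The reduction `R[p^{1/N}] → (R/p)⟦X⟧ / (X ^ N)`, `p^{1/N} ↦ X`. -/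
noncomputable def toTrunc (N : ℕ) : RootExt R (p : R) N →+*
    PowerSeries (R ⧸ Ideal.span {(p : R)}) ⧸
      Ideal.span {(PowerSeries.X : PowerSeries (R ⧸ Ideal.span {(p : R)})) ^ N} :=
  AdjoinRoot.lift ((polyMap p R N).comp Polynomial.C) (polyMap p R N Polynomial.X)
    ((eval₂_polyMap N _).trans (polyMap_X_pow_sub_C N))

lemma toTrunc_mk (N : ℕ) (f : Polynomial R) :
    toTrunc p R N (AdjoinRoot.mk _ f) = polyMap p R N f :=
  (AdjoinRoot.lift_mk _ _).trans (eval₂_polyMap N f)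

lemma toTrunc_surjective (N : ℕ) : Function.Surjective (toTrunc p R N) := by
  intro y
  obtain ⟨f, rfl⟩ := Ideal.Quotient.mk_surjective y
  -- Modulo `X ^ N` a series equals its truncation, a polynomial, whose coefficients lift to `R`.
  obtain ⟨g, hg⟩ := Polynomial.map_surjective _
    (Ideal.Quotient.mk_surjective (I := Ideal.span {(p : R)})) (PowerSeries.trunc N f)
  refine ⟨AdjoinRoot.mk _ g, ?_⟩
  rw [toTrunc_mk, polyMap_apply, hg, Ideal.Quotient.eq, Ideal.mem_span_singleton,
    PowerSeries.X_pow_dvd_iff]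
  intro m hm
  rw [map_sub, Polynomial.coeff_coe, PowerSeries.coeff_trunc, if_pos hm, sub_self]

/-- For a representative of degree below `N`, no coefficient is lost modulo `X ^ N`; vanishing thus
means that `p` divides every coefficient. -/
lemma ker_toTrunc {N : ℕ} (hN : N ≠ 0) :
    RingHom.ker (toTrunc p R N) = Ideal.span {(p : RootExt R (p : R) N)} := by
  refine le_antisymm (fun x hx => ?_) ?_
  · obtain ⟨g, rfl, hg⟩ := RootExt.exists_mk_eq _ hN x
    rw [RingHom.mem_ker, toTrunc_mk, polyMap_apply, PowerSeries.mk_eq_zero_iff_X_pow_dvd,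
      PowerSeries.X_pow_dvd_iff] at hx
    have h1 : Polynomial.C (p : R) ∣ g := by
      rw [Polynomial.C_dvd_iff_dvd_coeff]
      intro n
      rcases lt_or_ge n N with h | h
      · have := hx n h
        rwa [Polynomial.coeff_coe, Polynomial.coeff_map, Ideal.Quotient.eq_zero_iff_mem,
          Ideal.mem_span_singleton] at this
      · rw [hg n h]
        exact dvd_zero _
    rw [Ideal.mem_span_singleton]
    have h2 := map_dvd (AdjoinRoot.mk (Polynomial.X ^ N - Polynomial.C (p : R))) h1
    rwa [AdjoinRoot.mk_C, map_natCast] at h2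
  · rw [Ideal.span_singleton_le_iff_mem, RingHom.mem_ker, map_natCast,
      ← map_natCast (Ideal.Quotient.mk _), ← map_natCast PowerSeries.C,
      ← map_natCast (Ideal.Quotient.mk (Ideal.span {(p : R)})),
      Ideal.Quotient.eq_zero_iff_mem.mpr (Ideal.mem_span_singleton_self (p : R)), map_zero,
      map_zero]

variable [hp : Fact p.Prime] {θ : R →+* R} (F : FrobeniusFactorization p (R ⧸ Ideal.span {(p : R)}))

lemma toTrunc_map (hθ : ∀ r, F.θ (Ideal.Quotient.mk _ r) = Ideal.Quotient.mk _ (θ r)) (i : ℕ)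
    (g : Polynomial R) :
    toTrunc p R (p ^ (i + 1)) (RootExt.map θ (map_natCast θ p) p i (AdjoinRoot.mk _ g)) =
      Ideal.Quotient.mk _ (F.psi (g.map (Ideal.Quotient.mk (Ideal.span {(p : R)})) :
        Polynomial (R ⧸ Ideal.span {(p : R)}))) := by
  have h : ((toTrunc p R (p ^ (i + 1))).comp (RootExt.map θ (map_natCast θ p) p i)).comp
        (AdjoinRoot.mk _) =
      ((((Ideal.Quotient.mk (Ideal.span {(PowerSeries.X :
        PowerSeries (R ⧸ Ideal.span {(p : R)})) ^ p ^ (i + 1)})).comp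
        F.psi).comp Polynomial.coeToPowerSeries.ringHom).comp
        (Polynomial.mapRingHom (Ideal.Quotient.mk (Ideal.span {(p : R)})))) := by
    refine Polynomial.ringHom_ext (fun r => ?_) ?_
    · have h1 : RootExt.map θ (map_natCast θ p) p i (AdjoinRoot.mk _ (Polynomial.C r)) =
          AdjoinRoot.mk _ (Polynomial.C (θ r)) := by
        rw [AdjoinRoot.mk_C, AdjoinRoot.mk_C]
        exact RootExt.map_of θ (map_natCast θ p) p i r
      simp only [RingHom.comp_apply, Polynomial.coe_mapRingHom, Polynomial.map_C,
        Polynomial.coeToPowerSeries.ringHom_apply, Polynomial.coe_C]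
      rw [h1, toTrunc_mk, polyMap_C, F.psi_apply, PowerSeries.map_C, PowerSeries.expand_C, hθ]
    · have h1 : RootExt.map θ (map_natCast θ p) p i (AdjoinRoot.mk _ Polynomial.X) =
          AdjoinRoot.mk _ (Polynomial.X ^ p) := by
        rw [AdjoinRoot.mk_X, map_pow, AdjoinRoot.mk_X]
        exact RootExt.map_root θ (map_natCast θ p) p i
      simp only [RingHom.comp_apply, Polynomial.coe_mapRingHom, Polynomial.map_X,
        Polynomial.coeToPowerSeries.ringHom_apply, Polynomial.coe_X]
      rw [h1, toTrunc_mk, map_pow, polyMap_X, ← pow_one PowerSeries.X, F.psi_X_pow, mul_one,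
        pow_one, map_pow]
  exact RingHom.congr_fun h g

/-- The presentation of the layers of the tower `R[p^{1/pⁱ}]` modulo `p` by power series. -/
noncomputable def truncatedPresentation
    (hθ : ∀ r, F.θ (Ideal.Quotient.mk _ r) = Ideal.Quotient.mk _ (θ r)) :
    (rootTower θ p).TruncatedPresentation F where
  e i := toTrunc p R (p ^ i)
  surjective i := toTrunc_surjective (p ^ i)
  ker_eq i := ker_toTrunc (pow_ne_zero i hp.out.ne_zero)
  e_map i x f hf := by
    obtain ⟨g, rfl⟩ := AdjoinRoot.mk_surjective x
    refine (toTrunc_map F hθ i g).trans ?_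
    replace hf := (toTrunc_mk (p ^ i) g).symm.trans hf
    rw [polyMap_apply, Ideal.Quotient.eq, Ideal.mem_span_singleton] at hf
    -- The reduction of `g` and the given lift `f` agree modulo `X^{pⁱ}`, hence their images under
    -- `psi` agree modulo `X^{pⁱ⁺¹}`.
    rwa [Ideal.Quotient.eq, Ideal.mem_span_singleton, ← map_sub, F.X_pow_dvd_psi_iff]

end rootTower

/-! ### Transport along isomorphisms of towers. -/

namespace RingTower

/-- A truncated presentation is transported along an isomorphism of towers. -/
noncomputable def TruncatedPresentation.ofIso {p : ℕ} [hp : Fact p.Prime] {B : Type u} [CommRing B]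
    {T T' : RingTower.{u}} {F : FrobeniusFactorization p B} (E : T'.TruncatedPresentation F)
    (f : T.Iso T') : T.TruncatedPresentation F where
  e i := (E.e i).comp (f.equiv i).toRingHom
  surjective i := (E.surjective i).comp (f.equiv i).surjective
  ker_eq i := by
    ext x
    have h := Ideal.ext_iff.mp (E.ker_eq i) (f.equiv i x)
    rw [RingHom.mem_ker, Ideal.mem_span_singleton, ← map_natCast (f.equiv i) p,
      map_dvd_iff] at h
    rw [RingHom.mem_ker, Ideal.mem_span_singleton]
    exact h
  e_map i x g hg := by
    have h := E.e_map i (f.equiv i x) g hg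
    rw [← f.comm] at h
    exact h

/-- A tower isomorphic to the tower `R[p^{1/pⁱ}]` is perfectoid, provided that `p` is a
nonzerodivisor in the Jacobson radical of `R`, and that the Frobenius of `R / p` factors as `σ ∘ θ`. -/
theorem isPerfectoid_of_iso_rootTower {p : ℕ} [hp : Fact p.Prime] {R : Type u} [CommRing R]
    {θ : R →+* R} {F : FrobeniusFactorization p (R ⧸ Ideal.span {(p : R)})}
    (hθ : ∀ r, F.θ (Ideal.Quotient.mk _ r) = Ideal.Quotient.mk _ (θ r))
    (hreg : ∀ r : R, p * r = 0 → r = 0) (hjac : (p : R) ∈ (⊥ : Ideal R).jacobson)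
    {T : RingTower.{u}} (f : T.Iso (rootTower θ p)) :
    T.IsPerfectoid (Ideal.span {(p : T.obj 0)}) p := by
  have hN : ∀ i, p ^ i ≠ 0 := fun i => pow_ne_zero i hp.out.ne_zero
  obtain ⟨ϖ, hϖ, heϖ⟩ : ∃ ϖ : (rootTower θ p).obj 1, ϖ ^ p = (p : (rootTower θ p).obj 1) ∧
      (rootTower.truncatedPresentation F hθ).e 1 ϖ = Ideal.Quotient.mk _ PowerSeries.X := by
    -- The pillar is generated by `p^{1/p}`, whose reduction is `X`.
    refine ⟨AdjoinRoot.mk _ Polynomial.X, ?_, ?_⟩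
    · exact (congrArg (AdjoinRoot.root _ ^ ·) (pow_one p).symm).trans
        ((RootExt.root_pow (p : R) (p ^ 1)).trans (map_natCast (AdjoinRoot.of _) p))
    · exact (rootTower.toTrunc_mk (p ^ 1) _).trans (rootTower.polyMap_X _)
  refine ((rootTower.truncatedPresentation F hθ).ofIso f).isPerfectoid
    (ϖ := (f.equiv 1).symm ϖ) ?_ ?_ (fun i x hx => ?_) fun i => ?_
  · rw [← map_pow, hϖ, map_natCast]
  · exact (congrArg _ (RingEquiv.apply_symm_apply (f.equiv 1) ϖ)).trans heϖ
  · exact (f.equiv i).eq_zero_of_natCast_mul_eq_zero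
      (fun y hy => RootExt.eq_zero_of_natCast_mul_eq_zero (p : R) (hN i) hreg hy) hx
  · exact (f.equiv i).natCast_mem_jacobson_bot
      (RootExt.natCast_mem_jacobson_bot (p : R) (hN i) hjac)

end RingTower

/-! ## Adjoining roots of the variable to a power series ring -/

namespace PowerSeries

/-- All coefficients of `f` are combinations of one finite set of generators, so `f` is a finite
combination of them with power series coefficients. This is where finite generation enters. -/
lemma ker_map_eq {S B : Type*} [CommRing S] [CommRing B] {q : S →+* B}
    (h : (RingHom.ker q).FG) : RingHom.ker (map q) = (RingHom.ker q).map C := by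
  refine le_antisymm (fun f hf => ?_) ?_
  · obtain ⟨s, hs⟩ := h
    have h1 : ∀ n, ∃ c : S → S, ∑ a ∈ s, c a * a = coeff n f := fun n => by
      have h2 : coeff n f ∈ Ideal.span (s : Set S) := by
        have h3 := congrArg (coeff n) (RingHom.mem_ker.mp hf)
        rw [coeff_map, map_zero] at h3
        exact hs.symm ▸ h3
      obtain ⟨c, -, hc⟩ := Submodule.mem_span_finset.mp h2
      exact ⟨c, hc⟩
    choose c hc using h1
    have h4 : f = ∑ a ∈ s, mk (fun n => c n a) * C a := by
      ext n
      rw [map_sum, ← hc n]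
      exact Finset.sum_congr rfl fun a _ => by rw [coeff_mul_C, coeff_mk]
    rw [h4]
    refine Ideal.sum_mem _ fun a ha => Ideal.mul_mem_left _ _ (Ideal.mem_map_of_mem _ ?_)
    rw [← hs]
    exact Submodule.subset_span ha
  · rw [Ideal.map_le_iff_le_comap]
    intro a ha
    rw [Ideal.mem_comap, RingHom.mem_ker, map_C, RingHom.mem_ker.mp ha, map_zero]

/-- By uniqueness of division by `N`, the summand `Xˡ B⟦X^N⟧` only meets degrees congruent to `l`;
so `B⟦X⟧` is free over `B⟦X^N⟧` on `1, X, …, X^{N-1}`. -/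
lemma coeff_expand_mul_X_pow {B : Type*} [CommRing B] {N : ℕ} (hN : N ≠ 0) {j l : ℕ} (hj : j < N)
    (hl : l < N) (n : ℕ) (f : PowerSeries B) :
    coeff (N * n + j) (expand N hN f * X ^ l) = if l = j then coeff n f else 0 := by
  rw [coeff_mul_X_pow']
  split_ifs with h1 h2 h2
  · subst h2
    rw [Nat.add_sub_cancel, coeff_expand_mul]
  · refine coeff_expand_of_not_dvd N hN _ fun ⟨m, hm⟩ => h2 ?_
    have h3 : N * n + j = N * m + l := by omega
    have h4 := congrArg (· % N) h3
    simpa [Nat.mul_add_mod, Nat.mod_eq_of_lt hj, Nat.mod_eq_of_lt hl] using h4.symm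
  · omega
  · rfl

end PowerSeries

namespace RootExt

open PowerSeries

variable {S B : Type u} [CommRing S] [CommRing B] (e : S ≃+* PowerSeries B) {t : S}
  (ht : e t = PowerSeries.X) {N : ℕ} (hN : N ≠ 0)

/-- For a ring `S ≃ B⟦t⟧`, the map `S[t^{1/N}] → B⟦X⟧`, `t^{1/N} ↦ X`. -/
noncomputable def toPowerSeries : RootExt S t N →+* PowerSeries B :=
  AdjoinRoot.lift ((PowerSeries.expand N hN).toRingHom.comp e.toRingHom) PowerSeries.X <| by
    rw [Polynomial.eval₂_sub, Polynomial.eval₂_pow, Polynomial.eval₂_X, Polynomial.eval₂_C]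
    change PowerSeries.X ^ N - PowerSeries.expand N hN (e t) = 0
    rw [ht, PowerSeries.expand_X, sub_self]

lemma toPowerSeries_of (x : S) :
    toPowerSeries e ht hN (AdjoinRoot.of _ x) = PowerSeries.expand N hN (e x) :=
  AdjoinRoot.lift_of _

lemma toPowerSeries_root : toPowerSeries e ht hN (AdjoinRoot.root _) = PowerSeries.X :=
  AdjoinRoot.lift_root _

lemma toPowerSeries_mk {g : Polynomial S} (hg : ∀ n, N ≤ n → g.coeff n = 0) :
    toPowerSeries e ht hN (AdjoinRoot.mk _ g) =
      ∑ l ∈ Finset.range N, PowerSeries.expand N hN (e (g.coeff l)) * PowerSeries.X ^ l := by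
  have h : toPowerSeries e ht hN (AdjoinRoot.mk _ g) = Polynomial.eval₂
      ((PowerSeries.expand N hN).toRingHom.comp e.toRingHom) PowerSeries.X g :=
    AdjoinRoot.lift_mk _ _
  rw [h, Polynomial.eval₂_eq_sum_range' _ (n := N)]
  · rfl
  · exact Nat.lt_of_le_of_lt (Polynomial.natDegree_le_iff_coeff_eq_zero.mpr
      fun m hm => hg m (Nat.le_of_pred_lt hm)) (Nat.pred_lt hN)

lemma coeff_toPowerSeries_mk {g : Polynomial S} (hg : ∀ n, N ≤ n → g.coeff n = 0) {j : ℕ}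
    (hj : j < N) (n : ℕ) :
    PowerSeries.coeff (N * n + j) (toPowerSeries e ht hN (AdjoinRoot.mk _ g)) =
      PowerSeries.coeff n (e (g.coeff j)) := by
  rw [toPowerSeries_mk e ht hN hg, map_sum, Finset.sum_congr rfl fun l hl =>
    coeff_expand_mul_X_pow hN hj (Finset.mem_range.mp hl) n (e (g.coeff l)),
    Finset.sum_ite_eq', if_pos (Finset.mem_range.mpr hj)]

lemma toPowerSeries_injective : Function.Injective (toPowerSeries e ht hN) := by
  rw [injective_iff_map_eq_zero]
  intro x hx
  obtain ⟨g, rfl, hg⟩ := exists_mk_eq t hN x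
  have h : g = 0 := by
    ext j
    rcases lt_or_ge j N with hj | hj
    · refine e.injective (PowerSeries.ext fun n => ?_)
      rw [← coeff_toPowerSeries_mk e ht hN hg hj, hx, Polynomial.coeff_zero, map_zero, map_zero,
        map_zero]
    · rw [hg j hj, Polynomial.coeff_zero]
  rw [h, map_zero]

lemma toPowerSeries_surjective : Function.Surjective (toPowerSeries e ht hN) := by
  intro f
  -- The `j`-th coefficient of `g` collects the coefficients of `f` in degrees congruent to `j`
  -- modulo `N`.
  set g : Polynomial S := ∑ j ∈ Finset.range N, Polynomial.monomial j
    (e.symm (PowerSeries.mk fun n => PowerSeries.coeff (N * n + j) f)) with hg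
  have h1 : ∀ j, g.coeff j = if j < N then
      e.symm (PowerSeries.mk fun n => PowerSeries.coeff (N * n + j) f) else 0 := fun j => by
    rw [hg, Polynomial.finsetSum_coeff]
    simp only [Polynomial.coeff_monomial, Finset.sum_ite_eq', Finset.mem_range]
  have h2 : ∀ n, N ≤ n → g.coeff n = 0 := fun n hn => by rw [h1, if_neg (not_lt.mpr hn)]
  refine ⟨AdjoinRoot.mk _ g, PowerSeries.ext fun m => ?_⟩
  have hm : m % N < N := Nat.mod_lt _ (Nat.pos_of_ne_zero hN)
  rw [← Nat.div_add_mod m N, coeff_toPowerSeries_mk e ht hN h2 hm, h1, if_pos hm,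
    RingEquiv.apply_symm_apply, PowerSeries.coeff_mk]

/-- For a ring `S ≃ B⟦t⟧`, the isomorphism `S[t^{1/N}] ≃ B⟦X⟧`, `t^{1/N} ↦ X`. -/
noncomputable def powerSeriesEquiv : RootExt S t N ≃+* PowerSeries B :=
  RingEquiv.ofBijective (toPowerSeries e ht hN)
    ⟨toPowerSeries_injective e ht hN, toPowerSeries_surjective e ht hN⟩

end RootExt

/-- A tower `S₀ → S₁[t^{1/p}] → S₂[t^{1/p²}] → ⋯` with `Sᵢ ≃ B⟦t⟧` and transition maps which are `θ`
on the coefficients is isomorphic to the tower `B⟦X⟧ → B⟦X⟧ → ⋯`. -/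
noncomputable def FrobeniusFactorization.isoPowerSeriesTower {p : ℕ} [hp : Fact p.Prime]
    {B : Type u} [CommRing B] (F : FrobeniusFactorization p B) {S : ℕ → Type u}
    [∀ i, CommRing (S i)] (f : ∀ i, S i →+* S (i + 1)) (t : ∀ i, S i)
    (hft : ∀ i, f i (t i) = t (i + 1)) (e : ∀ i, S i ≃+* PowerSeries B)
    (het : ∀ i, e i (t i) = PowerSeries.X)
    (hef : ∀ i x, e (i + 1) (f i x) = PowerSeries.map F.θ (e i x)) :
    RingTower.Iso ⟨fun i => RootExt (S i) (t i) (p ^ i), fun i => RootExt.map (f i) (hft i) p i⟩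
      F.powerSeriesTower where
  equiv i := RootExt.powerSeriesEquiv (e i) (het i) (pow_ne_zero i hp.out.ne_zero)
  comm i x := by
    have hN : ∀ i, p ^ i ≠ 0 := fun i => pow_ne_zero i hp.out.ne_zero
    have h : (RootExt.toPowerSeries (e (i + 1)) (het (i + 1)) (hN (i + 1))).comp
        (RootExt.map (f i) (hft i) p i) =
        F.psi.comp (RootExt.toPowerSeries (e i) (het i) (hN i)) := by
      refine AdjoinRoot.ringHom_ext (RingHom.ext fun x => ?_) ?_
      · simp only [RingHom.comp_apply]
        rw [RootExt.map_of, RootExt.toPowerSeries_of, RootExt.toPowerSeries_of, hef, F.psi_apply,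
          PowerSeries.map_expand, ← PowerSeries.expand_mul]
        simp only [pow_succ']
      · simp only [RingHom.comp_apply]
        rw [RootExt.map_root, map_pow, RootExt.toPowerSeries_root, RootExt.toPowerSeries_root,
          ← pow_one PowerSeries.X, F.psi_X_pow, mul_one, pow_one]
    exact RingHom.congr_fun h x

open scoped TensorProduct

/-! ## The tower `Rᵢ ⊗ Vᵢ` as a tower `R[p^{1/pⁱ}]` -/

namespace FrobColim

variable {R : Type u} [CommRing R] (φ : R →+* R)

lemma of_iterate (i : ℕ) {a b : Fin (i + 1)} (hab : a ≤ b) (x : R) :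
    of φ i b (φ^[(b : ℕ) - (a : ℕ)] x) = of φ i a x :=
  Ring.DirectLimit.of_f (G := fun _ : Fin (i + 1) => R)
    (f := fun a b _ => (φ^[(b : ℕ) - (a : ℕ)] : R → R)) hab x

lemma trans_of (i : ℕ) (a : Fin (i + 1)) (x : R) :
    trans φ i (of φ i a x) = of φ (i + 1) a.castSucc x :=
  Ring.DirectLimit.lift_of (G := fun _ : Fin (i + 1) => R) _ _ _ a x

lemma exists_of_last (i : ℕ) (z : FrobColim φ i) : ∃ x, of φ i (Fin.last i) x = z := by
  obtain ⟨a, x, rfl⟩ := Ring.DirectLimit.exists_of (G := fun _ : Fin (i + 1) => R)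
    (f := fun a b _ => (φ^[(b : ℕ) - (a : ℕ)] : R → R)) z
  exact ⟨_, of_iterate φ i (Fin.le_last a) x⟩

/-- The map `Rᵢ → R` which is `φ ^ (i - a)` on the `a`-th copy of `R`. -/
noncomputable def toLast (i : ℕ) : FrobColim φ i →+* R :=
  Ring.DirectLimit.lift _ _ _ (fun a : Fin (i + 1) => φ ^ (i - (a : ℕ))) fun a b hab x => by
    have h : i - (a : ℕ) = (i - b) + (b - a) := by
      have h1 := b.is_le
      have h2 : (a : ℕ) ≤ b := hab
      omega
    rw [h, RingHom.coe_pow, RingHom.coe_pow, Function.iterate_add_apply]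

lemma toLast_of (i : ℕ) (a : Fin (i + 1)) (x : R) :
    toLast φ i (of φ i a x) = φ^[i - (a : ℕ)] x := by
  rw [← RingHom.coe_pow]
  exact Ring.DirectLimit.lift_of (G := fun _ : Fin (i + 1) => R) _ _ _ a x

lemma toLast_of_last (i : ℕ) (x : R) : toLast φ i (of φ i (Fin.last i) x) = x := by
  rw [toLast_of, Fin.val_last, Nat.sub_self, Function.iterate_zero_apply]

/-- The last index is final, so the colimit is the last copy of `R`. -/
lemma toLast_bijective (i : ℕ) : Function.Bijective (toLast φ i) := by
  refine ⟨fun z w h => ?_, fun x => ⟨_, toLast_of_last φ i x⟩⟩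
  obtain ⟨x, rfl⟩ := exists_of_last φ i z
  obtain ⟨y, rfl⟩ := exists_of_last φ i w
  rw [toLast_of_last, toLast_of_last] at h
  rw [h]

/-- The last copy in `Rᵢ` becomes the penultimate copy in `Rᵢ₊₁`, one application of `φ` away from
the end. -/
lemma toLast_trans (i : ℕ) (z : FrobColim φ i) :
    toLast φ (i + 1) (trans φ i z) = φ (toLast φ i z) := by
  obtain ⟨x, rfl⟩ := exists_of_last φ i z
  rw [trans_of, toLast_of_last, toLast_of]
  simp

variable {φ} {θ : R →+* R} {σ : R ≃+* R}

/-- `V` enters through the first copy of `R`, so it acts on the last copy through `φⁱ`. Twisting by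
`σ⁻ⁱ` leaves `θⁱ`, which fixes `V`; hence the twist in `equivTwist`. -/
lemma symm_iterate_iterate (hφ : ∀ x, φ x = σ (θ x)) (hσθ : ∀ x, σ (θ x) = θ (σ x)) (i : ℕ)
    (x : R) : σ.symm^[i] (φ^[i] x) = θ^[i] x := by
  have hc : Function.Commute σ θ := hσθ
  have h1 : (φ : R → R) = σ ∘ θ := funext hφ
  rw [h1, hc.comp_iterate, Function.comp_apply]
  exact (Function.LeftInverse.iterate σ.symm_apply_apply i) _

variable (hφ : ∀ x, φ x = σ (θ x)) (hσθ : ∀ x, σ (θ x) = θ (σ x))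
  {V : Type u} [CommRing V] [Algebra V R] (hθ : ∀ v : V, θ (algebraMap V R v) = algebraMap V R v)

/-- The isomorphism `Rᵢ ≃ R` of `V`-algebras given by `φ ^ (i - a)` on the `a`-th copy of `R`,
followed by `σ ^ (-i)`. -/
noncomputable def equivTwist (i : ℕ) : FrobColim φ i ≃ₐ[V] R :=
  AlgEquiv.ofRingEquiv
    (f := (RingEquiv.ofBijective (toLast φ i) (toLast_bijective φ i)).trans (σ.symm ^ i))
    fun v => by
    have h1 : toLast φ i (algebraMap V (FrobColim φ i) v) = φ^[i] (algebraMap V R v) :=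
      toLast_of φ i 0 _
    have h2 : θ^[i] (algebraMap V R v) = algebraMap V R v := Function.iterate_fixed (hθ v) i
    change (σ.symm ^ i) (toLast φ i (algebraMap V (FrobColim φ i) v)) = _
    rw [RingAut.coe_pow, h1, symm_iterate_iterate hφ hσθ, h2]

lemma equivTwist_apply (i : ℕ) (z : FrobColim φ i) :
    equivTwist hφ hσθ hθ i z = σ.symm^[i] (toLast φ i z) :=
  congrFun (RingAut.coe_pow σ.symm i) _

/-- The transition is `φ = σ ∘ θ`, and the additional `σ⁻¹` in layer `i + 1` cancels `σ`. -/
lemma equivTwist_trans (i : ℕ) (z : FrobColim φ i) :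
    equivTwist hφ hσθ hθ (i + 1) (trans φ i z) = θ (equivTwist hφ hσθ hθ i z) := by
  have hc : Function.Commute σ.symm θ := fun x => by
    apply σ.injective
    rw [hσθ, RingEquiv.apply_symm_apply, RingEquiv.apply_symm_apply]
  rw [equivTwist_apply, equivTwist_apply, toLast_trans, hφ, Function.iterate_succ_apply,
    RingEquiv.symm_apply_apply]
  exact hc.iterate_left i _

end FrobColim

/-! ### Base change of `V[a^{1/N}]`. -/

namespace RootExt

variable {V A R : Type u} [CommRing V] [CommRing A] [CommRing R] [Algebra V A] [Algebra V R]

/-- Scalars from `V` in the right factor can be moved to the left, so only the root remains to be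
tested there. -/
lemma tensor_ringHom_ext {C : Type*} [CommRing C] {a : V} {N : ℕ}
    {f g : A ⊗[V] RootExt V a N →+* C} (h1 : ∀ x : A, f (x ⊗ₜ 1) = g (x ⊗ₜ 1))
    (h2 : f (1 ⊗ₜ AdjoinRoot.root _) = g (1 ⊗ₜ AdjoinRoot.root _)) : f = g := by
  have h3 : f.comp (Algebra.TensorProduct.includeRight : RootExt V a N →ₐ[V] _).toRingHom =
      g.comp (Algebra.TensorProduct.includeRight : RootExt V a N →ₐ[V] _).toRingHom := by
    refine AdjoinRoot.ringHom_ext (RingHom.ext fun v => ?_) h2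
    have h4 : (1 : A) ⊗ₜ[V] (AdjoinRoot.of _ v : RootExt V a N) = algebraMap V A v ⊗ₜ 1 := by
      rw [← AdjoinRoot.algebraMap_eq, ← Algebra.TensorProduct.algebraMap_apply,
        Algebra.TensorProduct.algebraMap_apply']
    change f ((1 : A) ⊗ₜ[V] (AdjoinRoot.of _ v : RootExt V a N)) = g (1 ⊗ₜ _)
    rw [h4, h1]
  refine RingHom.ext fun z => ?_
  induction z with
  | zero => rw [map_zero, map_zero]
  | add x y hx hy => rw [map_add, map_add, hx, hy]
  | tmul x y =>
    have h5 : x ⊗ₜ[V] y = (x ⊗ₜ 1) * (1 ⊗ₜ y) := by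
      rw [Algebra.TensorProduct.tmul_mul_tmul, mul_one, one_mul]
    rw [h5, map_mul, map_mul, h1]
    exact congrArg _ (RingHom.congr_fun h3 y)

variable (E : A ≃ₐ[V] R) {a : V} {b : R} (hab : algebraMap V R a = b) (N : ℕ)

/-- The map `A ⊗ V[a^{1/N}] → R[a^{1/N}]`, for `A ≃ R`. -/
noncomputable def ofTensor : A ⊗[V] RootExt V a N →+* RootExt R b N :=
  (Algebra.TensorProduct.lift ((AdjoinRoot.ofAlgHom V _).comp E.toAlgHom)
    (AdjoinRoot.liftAlgHom _ (Algebra.ofId V (RootExt R b N)) (root R b N) (by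
      rw [Polynomial.eval₂_sub, Polynomial.eval₂_pow, Polynomial.eval₂_X, Polynomial.eval₂_C,
        root_pow, ← hab]
      exact sub_self _))
    fun _ _ => Commute.all _ _).toRingHom

lemma ofTensor_tmul_one (x : A) : ofTensor E hab N (x ⊗ₜ 1) = AdjoinRoot.of _ (E x) := by
  refine (Algebra.TensorProduct.lift_tmul _ _ _ _ _).trans ?_
  rw [map_one, mul_one]
  rfl

lemma ofTensor_one_tmul_root :
    ofTensor E hab N (1 ⊗ₜ AdjoinRoot.root _) = AdjoinRoot.root _ := by
  refine (Algebra.TensorProduct.lift_tmul _ _ _ _ _).trans ?_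
  rw [map_one, one_mul]
  exact AdjoinRoot.liftAlgHom_root _ _ _ _

/-- The map `R[a^{1/N}] → A ⊗ V[a^{1/N}]`, for `A ≃ R`. -/
noncomputable def toTensor : RootExt R b N →+* A ⊗[V] RootExt V a N :=
  AdjoinRoot.lift (Algebra.TensorProduct.includeLeftRingHom.comp E.symm.toRingEquiv.toRingHom)
    (1 ⊗ₜ AdjoinRoot.root _) <| by
    rw [Polynomial.eval₂_sub, Polynomial.eval₂_pow, Polynomial.eval₂_X, Polynomial.eval₂_C,
      Algebra.TensorProduct.tmul_pow, one_pow]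
    have h1 := root_pow a N
    rw [root] at h1
    rw [h1, sub_eq_zero, ← hab, ← AdjoinRoot.algebraMap_eq,
      ← Algebra.TensorProduct.algebraMap_apply', Algebra.TensorProduct.algebraMap_apply, ← E.symm.commutes]
    rfl

lemma toTensor_of (x : R) : toTensor E hab N (AdjoinRoot.of _ x) = E.symm x ⊗ₜ 1 :=
  AdjoinRoot.lift_of _

lemma toTensor_root : toTensor E hab N (AdjoinRoot.root _) = 1 ⊗ₜ AdjoinRoot.root _ :=
  AdjoinRoot.lift_root _

/-- The base change isomorphism `A ⊗ V[a^{1/N}] ≃ R[a^{1/N}]`, for `A ≃ R`. -/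
noncomputable def tensorEquiv : A ⊗[V] RootExt V a N ≃+* RootExt R b N :=
  RingEquiv.ofRingHom (ofTensor E hab N) (toTensor E hab N)
    (AdjoinRoot.ringHom_ext (RingHom.ext fun x => by
      simp only [RingHom.comp_apply, toTensor_of, ofTensor_tmul_one, AlgEquiv.apply_symm_apply,
        RingHom.id_apply]) (by
      simp only [RingHom.comp_apply, toTensor_root, ofTensor_one_tmul_root, RingHom.id_apply]))
    (tensor_ringHom_ext (fun x => by
      simp only [RingHom.comp_apply, toTensor_of, ofTensor_tmul_one, AlgEquiv.symm_apply_apply,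
        RingHom.id_apply]) (by
      simp only [RingHom.comp_apply, toTensor_root, ofTensor_one_tmul_root, RingHom.id_apply]))

lemma tensorEquiv_tmul_one (x : A) : tensorEquiv E hab N (x ⊗ₜ 1) = AdjoinRoot.of _ (E x) :=
  ofTensor_tmul_one E hab N x

/-- The exponent is `p ^ 0` in the application, hence a hypothesis `N = 1`. -/
lemma of_bijective (b : R) {N : ℕ} (hN : N = 1) :
    Function.Bijective (AdjoinRoot.of (Polynomial.X ^ N - Polynomial.C b)) := by
  subst hN
  constructor
  · rw [injective_iff_map_eq_zero]
    intro x hx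
    have h := eq_zero_of_mk_eq_zero b one_ne_zero (g := Polynomial.C x)
      (fun n hn => Polynomial.coeff_C_of_ne_zero (Nat.one_le_iff_ne_zero.mp hn)) hx
    exact Polynomial.C_eq_zero.mp h
  · intro y
    obtain ⟨g, rfl, hg⟩ := exists_mk_eq b one_ne_zero y
    refine ⟨g.coeff 0, ?_⟩
    rw [← AdjoinRoot.mk_C, ← Polynomial.eq_C_of_natDegree_le_zero
      (Polynomial.natDegree_le_iff_coeff_eq_zero.mpr hg)]

end RootExt

section TensorTower

variable {R : Type u} [CommRing R] {φ θ : R →+* R} {σ : R ≃+* R} (hφ : ∀ x, φ x = σ (θ x))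
  (hσθ : ∀ x, σ (θ x) = θ (σ x)) {V : Type u} [CommRing V] [Algebra V R]
  (hθ : ∀ v : V, θ (algebraMap V R v) = algebraMap V R v) (p : ℕ)

/-- If `φ = σ ∘ θ` with an automorphism `σ` and a `V`-linear `θ`, then the tower `Rᵢ ⊗ Vᵢ` is
isomorphic to the tower `R[p^{1/pⁱ}]` with transition maps induced by `θ`. -/
noncomputable def tensorTowerIso : (tensorTower φ V p).Iso (rootTower θ p) where
  equiv i := RootExt.tensorEquiv (FrobColim.equivTwist hφ hσθ hθ i) (map_natCast _ p) (p ^ i)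
  comm i x := by
    have h : (RootExt.ofTensor (FrobColim.equivTwist hφ hσθ hθ (i + 1))
          (map_natCast (algebraMap V R) p) (p ^ (i + 1))).comp
        (Algebra.TensorProduct.map (FrobColim.transAlgHom φ V i)
          (RootExt.incl V (p : V) p i)).toRingHom =
        (RootExt.map θ (map_natCast θ p) p i).comp
          (RootExt.ofTensor (FrobColim.equivTwist hφ hσθ hθ i)
            (map_natCast (algebraMap V R) p) (p ^ i)) := by
      refine RootExt.tensor_ringHom_ext (fun x => ?_) ?_
      · rw [RingHom.comp_apply, RingHom.comp_apply, RootExt.ofTensor_tmul_one, RootExt.map_of,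
          ← FrobColim.equivTwist_trans]
        refine Eq.trans ?_ (RootExt.ofTensor_tmul_one _ (map_natCast (algebraMap V R) p) _ _)
        refine congrArg _ ((Algebra.TensorProduct.map_tmul _ _ _ _).trans ?_)
        rw [map_one]
        rfl
      · rw [RingHom.comp_apply, RingHom.comp_apply, RootExt.ofTensor_one_tmul_root,
          RootExt.map_root]
        have h1 : (Algebra.TensorProduct.map (FrobColim.transAlgHom φ V i)
            (RootExt.incl V (p : V) p i)).toRingHom (1 ⊗ₜ AdjoinRoot.root _) =
            (1 ⊗ₜ AdjoinRoot.root _) ^ p := by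
          refine (Algebra.TensorProduct.map_tmul _ _ _ _).trans ?_
          rw [map_one, Algebra.TensorProduct.tmul_pow, one_pow]
          exact congrArg _ (RootExt.map_root (RingHom.id V) rfl p i)
        rw [h1, map_pow, RootExt.ofTensor_one_tmul_root]
    exact RingHom.congr_fun h x

lemma toTensorTower_bijective (hφ : ∀ x, φ x = σ (θ x)) (hσθ : ∀ x, σ (θ x) = θ (σ x))
    (hθ : ∀ v : V, θ (algebraMap V R v) = algebraMap V R v) (p : ℕ) :
    Function.Bijective (toTensorTower φ V p) := by
  have h : ∀ x, RootExt.tensorEquiv (FrobColim.equivTwist hφ hσθ hθ 0)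
      (map_natCast (algebraMap V R) p) (p ^ 0) (FrobColim.of φ 0 0 x ⊗ₜ 1) =
      AdjoinRoot.of _ x := fun x => by
    rw [RootExt.tensorEquiv_tmul_one, FrobColim.equivTwist_apply, FrobColim.toLast_of]
    rfl
  have h1 : ⇑(toTensorTower φ V p) = (RootExt.tensorEquiv (FrobColim.equivTwist hφ hσθ hθ 0)
      (map_natCast (algebraMap V R) p) (p ^ 0)).symm ∘ AdjoinRoot.of _ :=
    funext fun x => ((RingEquiv.symm_apply_eq _).mpr (h x).symm).symm
  rw [h1]
  exact (RingEquiv.bijective _).comp (RootExt.of_bijective (p : R) (pow_zero p))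

end TensorTower

/-! ## `p`-torsion freeness of quotients by Frobenius-stable ideals -/

namespace Ideal

variable {A : Type*} [CommRing A] {p : ℕ} [hp : Fact p.Prime] {φ : A →+* A} {I : Ideal A}

/-- If `φ` lifts the Frobenius and `(φ(f) - f ^ p) / p ∈ I` holds for generators of `I`, then it
holds for all `f ∈ I`. -/
lemma exists_frobLift_sub_pow_eq {S : Set A} (hφ : ∀ x, (p : A) ∣ φ x - x ^ p)
    (hS : ∀ f ∈ S, ∃ h ∈ span S, φ f - f ^ p = p * h) {f : A} (hf : f ∈ span S) :
    ∃ h ∈ span S, φ f - f ^ p = p * h := by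
  induction hf using Submodule.span_induction with
  | mem f hf => exact hS f hf
  | zero => exact ⟨0, zero_mem _, by rw [map_zero, zero_pow hp.out.ne_zero, sub_zero, mul_zero]⟩
  | add f g hf _ ihf ihg =>
    obtain ⟨h₁, h₁_mem, e₁⟩ := ihf
    obtain ⟨h₂, h₂_mem, e₂⟩ := ihg
    obtain ⟨r, hr⟩ := (Commute.all f g).exists_add_pow_prime_eq hp.out
    -- This is `δ(f + g) = δ(f) + δ(g) - ((f + g)ᵖ - fᵖ - gᵖ)/p`; the last term is a multiple of `f
    -- * g`.
    refine ⟨h₁ + h₂ - f * (g * r), sub_mem (add_mem h₁_mem h₂_mem) (mul_mem_right _ _ hf), ?_⟩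
    rw [map_add, hr]
    linear_combination e₁ + e₂
  | smul a f hf ih =>
    obtain ⟨h, h_mem, e⟩ := ih
    obtain ⟨c, hc⟩ := hφ a
    -- This is `δ(af) = φ(a) δ(f) + fᵖ δ(a)`.
    refine ⟨φ a * h + c * f ^ p, add_mem (mul_mem_left _ _ h_mem)
      (mul_mem_left _ _ (pow_mem_of_mem _ hf _ hp.out.pos)), ?_⟩
    rw [smul_eq_mul, map_mul, mul_pow]
    linear_combination φ a * e + f ^ p * hc

/-- In the expansion of `xᵖ = ((x - y) + y)ᵖ` the mixed terms are divisible by `p (x - y)`: if `δ`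
kills `x` and `y`, then `δ(x - y)` is a multiple of `x - y`. -/
lemma exists_sub_pow_eq {x y : A} (hx : φ x = x ^ p) (hy : φ y = y ^ p) :
    ∃ g, φ (x - y) - (x - y) ^ p = p * ((x - y) * g) := by
  obtain ⟨r, hr⟩ := (Commute.all (x - y) y).exists_add_pow_prime_eq hp.out
  refine ⟨y * r, ?_⟩
  rw [sub_add_cancel] at hr
  rw [map_sub, hx, hy, hr]
  ring

/-- Let `A` be `p`-torsion free and `p`-adically complete with a lift `φ` of the Frobenius, and let
`I` be a finitely generated ideal with `(φ(f) - f ^ p) / p ∈ I` for `f ∈ I`. If `A / (I + pA)` is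
reduced, then `A / I` is `p`-torsion free. -/
theorem mem_of_natCast_mul_mem (hφ : ∀ x, (p : A) ∣ φ x - x ^ p)
    (hI : ∀ f ∈ I, ∃ h ∈ I, φ f - f ^ p = (p : A) * h) (hfg : I.FG)
    (hreg : ∀ x : A, p * x = 0 → x = 0) (hsep : ∀ x : A, (∀ n, (p : A) ^ n ∣ x) → x = 0)
    (hcompl : ∀ a : ℕ → A, ∃ b, ∀ n, (p : A) ^ n ∣ b - ∑ i ∈ Finset.range n, (p : A) ^ i * a i)
    (hred : ∀ x : A, x ^ p ∈ I ⊔ span {(p : A)} → x ∈ I ⊔ span {(p : A)}) {x : A}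
    (hx : p * x ∈ I) : x ∈ I := by
  -- Cancelling `p` gives `φ(x) = δ(px) + x (px)^{p-1}`; both terms lie in `I`, the second because
  -- `p - 1 > 0`.
  have h1 : ∀ x : A, p * x ∈ I → φ x ∈ I := fun x hx => by
    obtain ⟨h, h_mem, e⟩ := hI _ hx
    have h2 : φ x = h + x * (p * x) ^ (p - 1) := by
      rw [← sub_eq_zero]
      apply hreg
      have h3 : (p * x) ^ p = p * x * (p * x) ^ (p - 1) := by
        rw [← pow_succ', Nat.sub_add_cancel hp.out.one_le]
      rw [map_mul, map_natCast, h3] at e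
      linear_combination e
    rw [h2]
    exact add_mem h_mem (mul_mem_left _ _ (pow_mem_of_mem _ hx _ (Nat.sub_pos_of_lt hp.out.one_lt)))
  have h2 : ∀ x, φ x ∈ I ⊔ span {(p : A)} → x ∈ I ⊔ span {(p : A)} := fun x hx => by
    apply hred
    have h3 : x ^ p = φ x - (φ x - x ^ p) := by ring
    rw [h3]
    exact sub_mem hx (mem_sup_right (mem_span_singleton.mpr (hφ x)))
  -- Each factor of `p` is traded for one application of `φ`, so the induction must cover all `x` at
  -- once.
  have h3 : ∀ n x, (p : A) ^ n * x ∈ I → x ∈ I ⊔ span {(p : A)} := fun n => by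
    induction n with
    | zero => exact fun x hx => mem_sup_left (by simpa using hx)
    | succ n ih =>
      intro x hx
      rw [pow_succ', mul_assoc] at hx
      have h4 := h1 _ hx
      rw [map_mul, map_pow, map_natCast] at h4
      exact h2 x (ih _ h4)
  -- Writing `x = i + p y` with `i ∈ I` makes `y` torsion of one order higher, so the division by
  -- `p` can be repeated forever.
  have h4 : ∀ n x, (p : A) ^ (n + 1) * x ∈ I →
      ∃ y, (p : A) ^ (n + 2) * y ∈ I ∧ x - p * y ∈ I := fun n x hx => by
    obtain ⟨i, hi, z, hz, rfl⟩ := Submodule.mem_sup.mp (h3 _ x hx)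
    obtain ⟨y, rfl⟩ := mem_span_singleton.mp hz
    refine ⟨y, ?_, by rwa [add_sub_cancel_right]⟩
    have h5 : (p : A) ^ (n + 2) * y = (p : A) ^ (n + 1) * (i + p * y) - (p : A) ^ (n + 1) * i := by
      ring
    rw [h5]
    exact sub_mem hx (mul_mem_left _ _ hi)
  choose! y hy hxy using h4
  let s : ℕ → A := fun n => Nat.rec x (fun n z => y n z) n
  have hs : ∀ n, (p : A) ^ (n + 1) * s n ∈ I := fun n => by
    induction n with
    | zero => simpa [s] using hx
    | succ n ih => exact hy n _ ih
  have hs' : ∀ n, s n - p * s (n + 1) ∈ I := fun n => hxy n _ (hs n)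
  -- The expansion `x = ∑ pⁿ (s n - p s (n + 1))` has terms in `I`. Expressing them in finitely many
  -- generators and summing the coefficients `p`-adically puts the limit in `I` itself, not just in
  -- its closure.
  obtain ⟨t, ht⟩ := hfg
  have h5 : ∀ n, ∃ c : A → A, ∑ a ∈ t, c a * a = s n - p * s (n + 1) := fun n => by
    obtain ⟨c, -, hc⟩ := Submodule.mem_span_finset.mp (ht.ge (hs' n))
    exact ⟨c, hc⟩
  choose c hc using h5
  choose b hb using fun a => hcompl fun n => c n a
  have h6 : ∀ n, x - ∑ i ∈ Finset.range n, (p : A) ^ i * (s i - p * s (i + 1)) = p ^ n * s n := by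
    intro n
    induction n with
    | zero => simp [s]
    | succ n ih => rw [Finset.sum_range_succ, ← sub_sub, ih]; ring
  have h7 : x = ∑ a ∈ t, b a * a := by
    rw [← sub_eq_zero]
    refine hsep _ fun n => ?_
    have h8 : x - ∑ a ∈ t, b a * a = p ^ n * s n -
        ∑ a ∈ t, (b a - ∑ i ∈ Finset.range n, (p : A) ^ i * c i a) * a := by
      rw [← h6 n]
      simp only [sub_mul, Finset.sum_sub_distrib, ← hc, Finset.mul_sum, Finset.sum_mul, mul_assoc]
      rw [Finset.sum_comm]
      ring
    rw [h8]
    exact dvd_sub (dvd_mul_right _ _) (Finset.dvd_sum fun a _ => Dvd.dvd.mul_right (hb a n) _)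
  rw [h7, ← ht]
  exact Ideal.sum_mem _ fun a ha => mul_mem_left _ _ (Submodule.subset_span ha)

end Ideal

/-! ### `p`-adic properties of multivariate power series, checked on coefficients. -/

namespace MvPowerSeries

variable {ι W : Type*} [CommRing W] (p : ℕ)

lemma natCast_pow_dvd_iff (n : ℕ) (f : MvPowerSeries ι W) :
    (p : MvPowerSeries ι W) ^ n ∣ f ↔ ∀ e, (p : W) ^ n ∣ coeff e f := by
  have h : (p : MvPowerSeries ι W) ^ n = C ((p : W) ^ n) := by rw [map_pow, map_natCast]
  constructor
  · rintro ⟨g, rfl⟩ e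
    rw [h, coeff_C_mul]
    exact dvd_mul_right _ _
  · intro hf
    choose g hg using hf
    have hG : ∃ G : MvPowerSeries ι W, ∀ e, coeff e G = g e := ⟨fun e => g e, fun _ => rfl⟩
    obtain ⟨G, hG⟩ := hG
    refine ⟨G, ext fun e => ?_⟩
    rw [h, coeff_C_mul, hG, hg]

variable {p}

lemma eq_zero_of_natCast_mul_eq_zero (hW : ∀ x : W, p * x = 0 → x = 0) {f : MvPowerSeries ι W}
    (hf : p * f = 0) : f = 0 := by
  ext e
  apply hW
  rw [← map_natCast (C : W →+* MvPowerSeries ι W)] at hf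
  rw [← coeff_C_mul, hf, map_zero]

variable [IsAdicComplete (Ideal.span {(p : W)}) W]

lemma eq_zero_of_forall_natCast_pow_dvd {f : MvPowerSeries ι W}
    (hf : ∀ n, (p : MvPowerSeries ι W) ^ n ∣ f) : f = 0 := by
  ext e
  refine IsHausdorff.haus (inferInstance : IsHausdorff (Ideal.span {(p : W)}) W) _ fun n => ?_
  rw [SModEq.zero, smul_eq_mul, Ideal.mul_top, Ideal.span_singleton_pow, Ideal.mem_span_singleton]
  exact (natCast_pow_dvd_iff p n f).mp (hf n) e

lemma exists_forall_natCast_pow_dvd_sub_sum (a : ℕ → MvPowerSeries ι W) :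
    ∃ b, ∀ n, (p : MvPowerSeries ι W) ^ n ∣
      b - ∑ i ∈ Finset.range n, (p : MvPowerSeries ι W) ^ i * a i := by
  have h1 : ∀ e, ∃ L : W, ∀ n, (p : W) ^ n ∣
      L - ∑ i ∈ Finset.range n, (p : W) ^ i * coeff e (a i) := fun e => by
    obtain ⟨L, hL⟩ := IsPrecomplete.prec (inferInstance : IsPrecomplete (Ideal.span {(p : W)}) W)
      (f := fun n => ∑ i ∈ Finset.range n, (p : W) ^ i * coeff e (a i)) fun {m n} hmn => by
        rw [SModEq.sub_mem, smul_eq_mul, Ideal.mul_top, Ideal.span_singleton_pow,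
          Ideal.mem_span_singleton, ← Finset.sum_range_add_sum_Ico _ hmn,
          sub_add_cancel_left, dvd_neg]
        exact Finset.dvd_sum fun i hi =>
          Dvd.dvd.mul_right (pow_dvd_pow _ (Finset.mem_Ico.mp hi).1) _
    refine ⟨L, fun n => ?_⟩
    have h2 := hL n
    rw [SModEq.sub_mem, smul_eq_mul, Ideal.mul_top, Ideal.span_singleton_pow,
      Ideal.mem_span_singleton] at h2
    exact (dvd_sub_comm).mp h2
  choose L hL using h1
  obtain ⟨b, hb⟩ : ∃ b : MvPowerSeries ι W, ∀ e, coeff e b = L e := ⟨fun e => L e, fun _ => rfl⟩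
  refine ⟨b, fun n => (natCast_pow_dvd_iff p n _).mpr fun e => ?_⟩
  rw [map_sub, hb, map_sum]
  have h3 : ∀ i, coeff e ((p : MvPowerSeries ι W) ^ i * a i) = (p : W) ^ i * coeff e (a i) :=
    fun i => by rw [← coeff_C_mul, map_pow, map_natCast]
  simp only [h3]
  exact hL e n

/-- A power series is a unit when its constant coefficient is, and in the `p`-complete ring `W` the
element `p` lies in the Jacobson radical. -/
lemma natCast_mem_jacobson_bot :
    (p : MvPowerSeries ι W) ∈ (⊥ : Ideal (MvPowerSeries ι W)).jacobson := by
  rw [Ideal.mem_jacobson_bot]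
  intro y
  rw [isUnit_iff_constantCoeff, map_add, map_mul, map_one, map_natCast]
  have h := IsAdicComplete.le_jacobson_bot (Ideal.span {(p : W)}) (Ideal.mem_span_singleton_self _)
  exact Ideal.mem_jacobson_bot.mp h _

end MvPowerSeries

/-! ## Determinantal rings -/

/-- The factorization of the Frobenius of `R / p` induced by endomorphisms `σ`, `θ` of `R` for which
`σ ∘ θ` is a lift of the Frobenius. -/
noncomputable def FrobeniusFactorization.ofQuotient {R : Type u} [CommRing R] {p : ℕ}
    [hp : Fact p.Prime] (σ : R ≃+* R) (θ : R →+* R)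
    (h : ∀ x, σ (θ x) - x ^ p ∈ Ideal.span {(p : R)})
    (hred : IsReduced (R ⧸ Ideal.span {(p : R)})) :
    FrobeniusFactorization p (R ⧸ Ideal.span {(p : R)}) :=
  have hσ : Ideal.span {(p : R)} = (Ideal.span {(p : R)}).map (σ : R →+* R) := by
    rw [Ideal.map_span, Set.image_singleton, map_natCast]
  have hθ : Ideal.span {(p : R)} ≤ (Ideal.span {(p : R)}).comap θ := by
    rw [Ideal.span_singleton_le_iff_mem, Ideal.mem_comap, map_natCast]
    exact Ideal.mem_span_singleton_self _
  have hσθ : ∀ b, Ideal.quotientEquiv _ _ σ hσ (Ideal.quotientMap _ θ hθ b) = b ^ p := fun b => by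
    obtain ⟨x, rfl⟩ := Ideal.Quotient.mk_surjective b
    rw [Ideal.quotientMap_mk, Ideal.quotientEquiv_mk, ← map_pow]
    exact Ideal.Quotient.eq.mpr (h x)
  { σ := Ideal.quotientEquiv _ _ σ hσ
    θ := Ideal.quotientMap _ θ hθ
    σ_θ := hσθ
    -- If `θ b = 0` then `bᵖ = σ (θ b) = 0`, so `b = 0` as the quotient is reduced.
    θ_injective := (injective_iff_map_eq_zero _).mpr fun b hb => by
      have h1 := hσθ b
      rw [hb, map_zero] at h1
      exact (pow_eq_zero_iff hp.out.ne_zero).mp h1.symm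
    natCast_eq_zero := by
      rw [← map_natCast (Ideal.Quotient.mk _), Ideal.Quotient.eq_zero_iff_mem]
      exact Ideal.mem_span_singleton_self _ }

lemma FrobeniusFactorization.ofQuotient_θ_mk {R : Type u} [CommRing R] {p : ℕ}
    [hp : Fact p.Prime] (σ : R ≃+* R) (θ : R →+* R)
    (h : ∀ x, σ (θ x) - x ^ p ∈ Ideal.span {(p : R)})
    (hred : IsReduced (R ⧸ Ideal.span {(p : R)})) (r : R) :
    (ofQuotient σ θ h hred).θ (Ideal.Quotient.mk _ r) = Ideal.Quotient.mk _ (θ r) := rfl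

lemma minorsIdeal_map (t : ℕ) {m n : ℕ} {A B : Type*} [CommRing A] [CommRing B] (f : A →+* B)
    (N : Matrix (Fin m) (Fin n) A) : (minorsIdeal t N).map f = minorsIdeal t (N.map f) := by
  rw [minorsIdeal, minorsIdeal, Ideal.map_span, ← Set.range_comp]
  congr 2
  funext rc
  exact RingHom.map_det f _

lemma minorsIdeal_fg (t : ℕ) {m n : ℕ} {A : Type*} [CommRing A] (N : Matrix (Fin m) (Fin n) A) :
    (minorsIdeal t N).FG := Submodule.fg_span (Set.finite_range _)

section

variable (p : ℕ) [hp : Fact p.Prime] (k : Type u) [Field k] {d m n : ℕ}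
  (M : Matrix (Fin m) (Fin n) (Option (Finset (Fin d))))

/-- The endomorphism of `R = A / I₂(M)` which is the identity on `W(k)` and maps `X_j` to
`X_j ^ p`. -/
noncomputable abbrev DetRing.expand : DetRing p k M 0 →+* DetRing p k M 0 := DetRing.trans p k M 0

lemma DetRing.expand_algebraMap (v : WittVector p k) :
    DetRing.expand p k M (algebraMap _ _ v) = algebraMap _ _ v :=
  congrArg (Ideal.Quotient.mk _) ((MvPowerSeries.expand p hp.out.ne_zero).commutes v)

lemma DetRing.mk_mk_eq_zero_iff (f : RootSeries p k d 0) :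
    Ideal.Quotient.mk (Ideal.span {(p : DetRing p k M 0)}) (Ideal.Quotient.mk _ f) = 0 ↔
      f ∈ minorsIdeal 2 (rootMatrix p k M 0) ⊔ Ideal.span {(p : RootSeries p k d 0)} := by
  have h : Ideal.span {(p : DetRing p k M 0)} =
      (Ideal.span {(p : RootSeries p k d 0)}).map (Ideal.Quotient.mk _) := by
    rw [Ideal.map_span, Set.image_singleton, map_natCast]
  rw [Ideal.Quotient.eq_zero_iff_mem, h, ← Ideal.mem_comap, Ideal.comap_map_of_surjective' _
    Ideal.Quotient.mk_surjective, Ideal.mk_ker, sup_comm]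

/-- The surjection `Āᵢ → R / p`. -/
noncomputable def RootSeriesBar.toDetRing (i : ℕ) :
    RootSeriesBar p k d i →+* DetRing p k M 0 ⧸ Ideal.span {(p : DetRing p k M 0)} :=
  Ideal.Quotient.lift _ ((Ideal.Quotient.mk (Ideal.span {(p : DetRing p k M 0)})).comp
    (Ideal.Quotient.mk (minorsIdeal 2 (rootMatrix p k M 0)))) fun f hf =>
    (DetRing.mk_mk_eq_zero_iff p k M f).mpr (Ideal.mem_sup_right hf)

lemma RootSeriesBar.toDetRing_mk (i : ℕ) (f : RootSeries p k d i) :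
    RootSeriesBar.toDetRing p k M i (Ideal.Quotient.mk _ f) =
      Ideal.Quotient.mk (Ideal.span {(p : DetRing p k M 0)})
        (Ideal.Quotient.mk (minorsIdeal 2 (rootMatrix p k M 0)) f) := rfl

lemma RootSeriesBar.toDetRing_surjective (i : ℕ) :
    Function.Surjective (RootSeriesBar.toDetRing p k M i) := by
  intro y
  obtain ⟨y, rfl⟩ := Ideal.Quotient.mk_surjective y
  obtain ⟨f, rfl⟩ := Ideal.Quotient.mk_surjective y
  exact ⟨Ideal.Quotient.mk _ f, rfl⟩

/-- The layers `Aᵢ` share one underlying ring, in which `M^{1/pⁱ}` is literally `M`; the kernel is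
thus the same for all `i`. -/
lemma RootSeriesBar.ker_toDetRing (i : ℕ) : RingHom.ker (RootSeriesBar.toDetRing p k M i) =
    (minorsIdeal 2 (rootMatrix p k M i)).map
      (Ideal.Quotient.mk (Ideal.span {(p : RootSeries p k d i)})) := by
  ext x
  obtain ⟨f, rfl⟩ := Ideal.Quotient.mk_surjective x
  rw [RingHom.mem_ker, toDetRing_mk, DetRing.mk_mk_eq_zero_iff, ← Ideal.mem_comap,
    Ideal.comap_map_of_surjective' _ Ideal.Quotient.mk_surjective, Ideal.mk_ker]
  rfl

lemma ker_map_toDetRing (i : ℕ) :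
    RingHom.ker (PowerSeries.map (RootSeriesBar.toDetRing p k M i)) = detIdealBar p k M i := by
  rw [PowerSeries.ker_map_eq, RootSeriesBar.ker_toDetRing, detIdealBar]
  rw [RootSeriesBar.ker_toDetRing]
  exact (minorsIdeal_fg _ _).map _

/-- The isomorphism `Āᵢ⟦t⟧ / I₂(M^{1/pⁱ}) Āᵢ⟦t⟧ ≃ (R / p)⟦t⟧`. -/
noncomputable def DetRingBar.equiv (i : ℕ) : DetRingBar p k M i ≃+*
    PowerSeries (DetRing p k M 0 ⧸ Ideal.span {(p : DetRing p k M 0)}) :=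
  (Ideal.quotEquivOfEq (ker_map_toDetRing p k M i).symm).trans
    (RingHom.quotientKerEquivOfSurjective (PowerSeries.map_surjective _
      (RootSeriesBar.toDetRing_surjective p k M i)))

lemma DetRingBar.equiv_mk (i : ℕ) (f : PowerSeries (RootSeriesBar p k d i)) :
    DetRingBar.equiv p k M i (Ideal.Quotient.mk _ f) =
      PowerSeries.map (RootSeriesBar.toDetRing p k M i) f := rfl

lemma DetRingBar.equiv_t (i : ℕ) :
    DetRingBar.equiv p k M i (DetRingBar.t p k M i) = PowerSeries.X :=
  (DetRingBar.equiv_mk p k M i PowerSeries.X).trans (PowerSeries.map_X _)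

/-! ### The factorization of the Frobenius lift on `R`. -/

variable [CharP k p] [PerfectField k]

variable (d) in
/-- The Witt vector Frobenius on the coefficients, as an automorphism of `W(k)⟦X₁, …, X_d⟧`. -/
noncomputable def coeffFrob : RootSeries p k d 0 ≃+* RootSeries p k d 0 :=
  RingEquiv.ofRingHom
    (MvPowerSeries.map (WittVector.frobeniusEquiv p k).toRingHom)
    (MvPowerSeries.map (WittVector.frobeniusEquiv p k).symm.toRingHom)
    (by
      rw [← MvPowerSeries.map_comp]
      convert MvPowerSeries.map_id
      exact RingEquiv.toRingHom_comp_symm_toRingHom _)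
    (by
      rw [← MvPowerSeries.map_comp]
      convert MvPowerSeries.map_id
      exact RingEquiv.symm_toRingHom_comp_toRingHom _)

lemma coeffFrob_apply (f : RootSeries p k d 0) :
    coeffFrob p k d f = MvPowerSeries.map WittVector.frobenius f := rfl

lemma frobLift_eq (f : RootSeries p k d 0) :
    frobLift p k d f = coeffFrob p k d (RootSeries.incl p k d 0 f) :=
  (MvPowerSeries.map_expand p hp.out.ne_zero _ f).symm

lemma coeffFrob_rootMonomial (s : Option (Finset (Fin d))) :
    coeffFrob p k d (rootMonomial 0 s) = rootMonomial 0 s := by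
  cases s with
  | none => exact map_zero _
  | some s =>
    simp only [rootMonomial, map_prod]
    exact Finset.prod_congr rfl fun j _ => by rw [coeffFrob_apply, MvPowerSeries.map_X]

lemma map_coeffFrob_minorsIdeal :
    minorsIdeal 2 (rootMatrix p k M 0) =
      (minorsIdeal 2 (rootMatrix p k M 0)).map (coeffFrob p k d : _ →+* _) := by
  rw [minorsIdeal_map]
  congr 1
  exact Matrix.ext fun a b => (coeffFrob_rootMonomial p k (M a b)).symm

/-- The automorphism of `R = A / I₂(M)` induced by the Witt vector Frobenius on the coefficients. -/
noncomputable def DetRing.coeffFrob : DetRing p k M 0 ≃+* DetRing p k M 0 :=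
  Ideal.quotientEquiv _ _ (_root_.coeffFrob p k d) (map_coeffFrob_minorsIdeal p k M)

lemma DetRing.frob_eq (x : DetRing p k M 0) :
    DetRing.frob p k M x = DetRing.coeffFrob p k M (DetRing.expand p k M x) := by
  obtain ⟨f, rfl⟩ := Ideal.Quotient.mk_surjective x
  exact congrArg (Ideal.Quotient.mk _) (frobLift_eq p k f)

/-- `frobLift` is by definition `θ ∘ σ`, while `DetRing.frob_eq` gives `σ ∘ θ`. -/
lemma DetRing.coeffFrob_expand (x : DetRing p k M 0) :
    DetRing.coeffFrob p k M (DetRing.expand p k M x) =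
      DetRing.expand p k M (DetRing.coeffFrob p k M x) := by
  rw [← DetRing.frob_eq]
  obtain ⟨f, rfl⟩ := Ideal.Quotient.mk_surjective x
  rfl

lemma DetRing.coeffFrob_expand_sub_pow_mem (x : DetRing p k M 0) :
    DetRing.coeffFrob p k M (DetRing.expand p k M x) - x ^ p ∈
      Ideal.span {(p : DetRing p k M 0)} := by
  rw [← DetRing.frob_eq]
  obtain ⟨f, rfl⟩ := Ideal.Quotient.mk_surjective x
  obtain ⟨g, hg⟩ := Ideal.mem_span_singleton.mp (frobLift_sub_pow_mem p k d f)
  refine Ideal.mem_span_singleton.mpr ⟨Ideal.Quotient.mk _ g, ?_⟩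
  rw [← map_natCast (Ideal.Quotient.mk _), ← map_mul, ← hg]
  rfl

lemma DetRing.natCast_mem_jacobson_bot :
    (p : DetRing p k M 0) ∈ (⊥ : Ideal (DetRing p k M 0)).jacobson := by
  have h := MvPowerSeries.natCast_mem_jacobson_bot (ι := Fin d) (W := WittVector p k) (p := p)
  rw [Ideal.mem_jacobson_bot] at h ⊢
  intro y
  obtain ⟨f, rfl⟩ := Ideal.Quotient.mk_surjective y
  have h1 := (h f).map (Ideal.Quotient.mk (minorsIdeal 2 (rootMatrix p k M 0)))
  rwa [map_add, map_mul, map_one, map_natCast] at h1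

/-- Entries and their products satisfy `φ(x) = xᵖ`, and a `2 × 2`-minor is a difference of two such
products. Stability under `δ` therefore holds on generators, which suffices. -/
lemma exists_frobLift_sub_pow_eq_of_mem_minorsIdeal {f : RootSeries p k d 0}
    (hf : f ∈ minorsIdeal 2 (rootMatrix p k M 0)) :
    ∃ h ∈ minorsIdeal 2 (rootMatrix p k M 0), frobLift p k d f - f ^ p = p * h := by
  refine Ideal.exists_frobLift_sub_pow_eq
    (fun x => Ideal.mem_span_singleton.mp (frobLift_sub_pow_mem p k d x)) ?_ hf
  rintro _ ⟨rc, rfl⟩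
  have h1 : ∀ s t : Option (Finset (Fin d)), frobLift p k d (rootMonomial 0 s * rootMonomial 0 t) =
      (rootMonomial 0 s * rootMonomial 0 t) ^ p := fun s t => by
    rw [map_mul, frobLift_rootMonomial, frobLift_rootMonomial, mul_pow]
  obtain ⟨g, hg⟩ := Ideal.exists_sub_pow_eq (h1 (M (rc.1 0) (rc.2 0)) (M (rc.1 1) (rc.2 1)))
    (h1 (M (rc.1 0) (rc.2 1)) (M (rc.1 1) (rc.2 0)))
  refine ⟨_, Ideal.mul_mem_right g _ (Ideal.subset_span ⟨rc, rfl⟩), ?_⟩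
  simp only [Matrix.det_fin_two]
  exact hg

variable {M} in
lemma DetRing.eq_zero_of_natCast_mul_eq_zero
    (hred : IsReduced (DetRing p k M 0 ⧸ Ideal.span {(p : DetRing p k M 0)}))
    {x : DetRing p k M 0} (hx : p * x = 0) : x = 0 := by
  obtain ⟨f, rfl⟩ := Ideal.Quotient.mk_surjective x
  rw [Ideal.Quotient.eq_zero_iff_mem]
  rw [← map_natCast (Ideal.Quotient.mk _), ← map_mul, Ideal.Quotient.eq_zero_iff_mem] at hx
  refine Ideal.mem_of_natCast_mul_mem
    (fun x => Ideal.mem_span_singleton.mp (frobLift_sub_pow_mem p k d x))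
    (fun f hf => exists_frobLift_sub_pow_eq_of_mem_minorsIdeal p k M hf)
    (minorsIdeal_fg _ _)
    (fun x hx => MvPowerSeries.eq_zero_of_natCast_mul_eq_zero
      (fun y hy => WittVector.eq_zero_of_p_mul_eq_zero y (by rwa [mul_comm])) hx)
    (fun x hx => MvPowerSeries.eq_zero_of_forall_natCast_pow_dvd hx)
    (fun a => MvPowerSeries.exists_forall_natCast_pow_dvd_sub_sum a)
    (fun x hx => ?_) hx
  rw [← DetRing.mk_mk_eq_zero_iff, map_pow, map_pow] at hx
  rw [← DetRing.mk_mk_eq_zero_iff]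
  exact (pow_eq_zero_iff hp.out.ne_zero).mp hx

variable {M}
variable (hred : IsReduced (DetRing p k M 0 ⧸ Ideal.span {(p : DetRing p k M 0)}))

/-- The factorization of the Frobenius of `R / p` through `X_j ↦ X_jᵖ`. -/
noncomputable def DetRing.frobeniusFactorization :
    FrobeniusFactorization p (DetRing p k M 0 ⧸ Ideal.span {(p : DetRing p k M 0)}) :=
  FrobeniusFactorization.ofQuotient (DetRing.coeffFrob p k M) (DetRing.expand p k M)
    (DetRing.coeffFrob_expand_sub_pow_mem p k M) hred

lemma DetRingBar.equiv_trans (i : ℕ) (x : DetRingBar p k M i) :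
    DetRingBar.equiv p k M (i + 1) (DetRingBar.trans p k M i x) =
      PowerSeries.map (DetRing.frobeniusFactorization p k hred).θ (DetRingBar.equiv p k M i x) := by
  obtain ⟨f, rfl⟩ := Ideal.Quotient.mk_surjective x
  rw [DetRingBar.trans, Ideal.quotientMap_mk, equiv_mk, equiv_mk]
  ext n
  simp only [PowerSeries.coeff_map]
  obtain ⟨g, hg⟩ := Ideal.Quotient.mk_surjective (PowerSeries.coeff n f)
  rw [← hg]
  rfl

/-- The tower `(Āᵢ⟦t⟧ / I₂(M^{1/pⁱ}) Āᵢ⟦t⟧)[t^{1/pⁱ}]` is isomorphic to the tower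
`(R / p)⟦X⟧ → (R / p)⟦X⟧ → ⋯`. -/
noncomputable def detTowerBarIso : (detTowerBar p k M).Iso
    (DetRing.frobeniusFactorization p k hred).powerSeriesTower :=
  ((DetRing.frobeniusFactorization p k hred).isoPowerSeriesTower
    (S := fun i => DetRingBar p k M i) (DetRingBar.trans p k M) (DetRingBar.t p k M)
    (DetRingBar.trans_t p k M) (DetRingBar.equiv p k M) (DetRingBar.equiv_t p k M)
    (DetRingBar.equiv_trans p k hred) :)

end

/-! ### Composition of tower isomorphisms and the main theorem. -/

namespace RingTower.Iso

variable {T T' T'' : RingTower.{u}}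

/-- The inverse of an isomorphism of towers. -/
def symm (f : T.Iso T') : T'.Iso T where
  equiv i := (f.equiv i).symm
  comm i x := by
    rw [RingEquiv.symm_apply_eq, f.comm, RingEquiv.apply_symm_apply]

/-- The composite of two isomorphisms of towers. -/
def trans (f : T.Iso T') (g : T'.Iso T'') : T.Iso T'' where
  equiv i := (f.equiv i).trans (g.equiv i)
  comm i x := by
    simp only [RingEquiv.trans_apply, f.comm, g.comm]

end RingTower.Iso

theorem mainTheorem12 (p : ℕ) [Fact p.Prime] (k : Type u) [Field k] [CharP k p] [PerfectField k]
    (d m n : ℕ) (M : Matrix (Fin m) (Fin n) (Option (Finset (Fin d))))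
    (hred : IsReduced (DetRing p k M 0 ⧸ Ideal.span {(p : DetRing p k M 0)})) :
    Function.Bijective (toTensorTower (DetRing.frob p k M) (WittVector p k) p) ∧
    ∃ h : (tensorTower (DetRing.frob p k M) (WittVector p k) p).IsPerfectoid
        ((Ideal.span {(p : DetRing p k M 0)}).map
          (toTensorTower (DetRing.frob p k M) (WittVector p k) p)) p,
      Nonempty ((tensorTower (DetRing.frob p k M) (WittVector p k) p).Iso (detTower p k M)) ∧
      Nonempty ((RingTower.tilt h.toIsPurelyInseparable).Iso (detTowerBar p k M)) := by
  have hI : (Ideal.span {(p : DetRing p k M 0)}).map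
      (toTensorTower (DetRing.frob p k M) (WittVector p k) p) =
      Ideal.span {(p : (tensorTower (DetRing.frob p k M) (WittVector p k) p).obj 0)} := by
    rw [Ideal.map_span, Set.image_singleton, map_natCast]
  rw [hI]
  have f : (tensorTower (DetRing.frob p k M) (WittVector p k) p).Iso
      (rootTower (DetRing.expand p k M) p) :=
    tensorTowerIso (DetRing.frob_eq p k M) (DetRing.coeffFrob_expand p k M)
      (DetRing.expand_algebraMap p k M) p
  have hθ := FrobeniusFactorization.ofQuotient_θ_mk (DetRing.coeffFrob p k M)
    (DetRing.expand p k M) (DetRing.coeffFrob_expand_sub_pow_mem p k M) hred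
  have h := RingTower.isPerfectoid_of_iso_rootTower hθ
    (fun r hr => DetRing.eq_zero_of_natCast_mul_eq_zero p k hred hr)
    (DetRing.natCast_mem_jacobson_bot p k M) f
  -- `f` also serves as the isomorphism onto `detTower`: with all `Aᵢ` the same ring, that tower is
  -- definitionally the root tower of `DetRing.expand`.
  refine ⟨toTensorTower_bijective (DetRing.frob_eq p k M) (DetRing.coeffFrob_expand p k M)
    (DetRing.expand_algebraMap p k M) p, h, ⟨f⟩, ⟨?_⟩⟩
  -- The tilt and `detTowerBar` are compared through their common model, `(R/p)⟦X⟧` with transition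
  -- `psi`.
  exact (((rootTower.truncatedPresentation _ hθ).ofIso f).tiltIso h.toIsPurelyInseparable).trans
    (detTowerBarIso p k hred).symm
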